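/- Let $\mathbb{K}$ be an algebraically closed field, $n>1$, and let $P_1,\dots,P_r$ ($r\ge 1$) be pairwise distinct prime ideals of $\mathbb{K}[[X_1,\dots,X_n]]$ such that each $\mathcal{O}_i=\mathbb{K}[[X_1,\dots,X_n]]/P_i$ has Krull dimension one. Put $Q=P_1\cap\dots\cap P_r$, $\mathcal{O}=\mathbb{K}[[X_1,\dots,X_n]]/Q$, let $\mathcal{M}$ be the maximal ideal of $\mathcal{O}$, and assume $\dim_{\mathbb{K}}\mathcal{M}/\mathcal{M}^2=n$ (so $Q$ is a non-degenerate algebroid curve with branches $P_1,\dots,P_r$). For $g\in\mathcal{O}$ let $v_i(g)\in\mathbb{N}\cup\{\infty\}$ be the value of the image of $g$ in $\mathcal{O}_i$ under the normalized discrete valuation of the integral closure of $\mathcal{O}_i$ in its field of fractions, with $v_i(0)=\infty$. For a finite set $G=\{g_1,\dots,g_m\}\subset\mathcal{M}$ and $0\ne g\in\mathcal{O}$, an element $h\in\mathcal{O}$ is a reduction of $g$ modulo $G$ if $h=g-c\,g_1^{\alpha_1}\cdots g_m^{\alpha_m}$ for some $c\in\mathbb{K}$ and $\alpha_1,\dots,\alpha_m\in\mathbb{N}$,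 with $v_i(h)\ge v_i(g)$ for all $i$ and $v_k(h)>v_k(g)$ for some $k$ with $v_k(g)\neq\infty$. A nonempty finite set $G\subset\mathcal{M}\setminus\{0\}$ is a Standard Basis for $\mathcal{O}$ if every nonzero element of $\mathcal{O}$ has a reduction modulo $G$; a Standard Basis $G$ is minimal if no $g\in G$ has a reduction modulo $G\setminus\{g\}$. Then: (1) If $G$ is a Standard Basis for $\mathcal{O}$ and $g\in G$ admits a reduction modulo $H=G\setminus\{g\}$, then $H$ is a Standard Basis for $\mathcal{O}$. (2) Let $G$ be a Standard Basis for $\mathcal{O}$, and successively discard from it elements $g$ that have a reduction modulo the set of the other elements still present. Whenever no further element can be discarded, the remaining set is a minimal Standard Basis for $\mathcal{O}$; and some such sequence of discards leads from $G$ to a minimal Standard Basis. (3) A minimal Standard Basis for $\mathcal{O}$ exists. -/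

import Mathlib

namespace AlgebroidCurve

/-- `K[[X_1, …, X_n]]`. -/
abbrev PowerSeriesRing (K : Type*) [Field K] (n : ℕ) : Type _ := MvPowerSeries (Fin n) K

/-- The local ring `𝒪 = K[[X]] / Q` of the curve `Q = ⋂ i, P i`. -/
abbrev LocalRing {K : Type*} [Field K] {n r : ℕ} (P : Fin r → Ideal (PowerSeriesRing K n)) :
    Type _ :=
  PowerSeriesRing K n ⧸ (⨅ i, P i)

/-- The local ring `𝒪_i = K[[X]] / P_i` of the `i`-th branch. -/
abbrev BranchRing {K : Type*} [Field K] {n r : ℕ} (P : Fin r → Ideal (PowerSeriesRing K n))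
    (i : Fin r) : Type _ :=
  PowerSeriesRing K n ⧸ P i

/-- The canonical map `𝒪 → 𝒪_i`. -/
noncomputable def toBranch {K : Type*} [Field K] {n r : ℕ}
    (P : Fin r → Ideal (PowerSeriesRing K n)) (i : Fin r) : LocalRing P →+* BranchRing P i :=
  Ideal.Quotient.factor (iInf_le P i)

/-- The maximal ideal `ℳ` of `𝒪`: the image of the maximal ideal of `K[[X]]`. -/
noncomputable def maxIdeal {K : Type*} [Field K] {n r : ℕ}
    (P : Fin r → Ideal (PowerSeriesRing K n)) : Ideal (LocalRing P) :=
  (IsLocalRing.maximalIdeal (PowerSeriesRing K n)).map (Ideal.Quotient.mk (⨅ i, P i))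

/-- The family `P_1, …, P_r` is the family of branches of a (non-degenerate) algebroid curve
`Q = P_1 ∩ … ∩ P_r` in `K^n`: the `P_i` are pairwise distinct primes with one-dimensional
quotients (hence pairwise incomparable, so that they are exactly the isolated primes of the radical
ideal `Q`), there is at least one of them (`Q` is proper), and `dim_K ℳ/ℳ² = n > 1`. -/
structure IsAlgebroidCurve {K : Type*} [Field K] {n r : ℕ}
    (P : Fin r → Ideal (PowerSeriesRing K n)) : Prop where
  one_lt : 1 < n
  pos : 0 < r
  injective : Function.Injective P
  isPrime : ∀ i, (P i).IsPrime
  krullDim_eq_one : ∀ i, ringKrullDim (BranchRing P i) = 1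
  nondegenerate : Module.finrank K (maxIdeal P).Cotangent = n

/-- The order of `b` with respect to the Jacobson radical `J` of `B`: the supremum in `ℕ ∪ {∞}` of
all `m` with `b ∈ J ^ m`. If `B` is a discrete valuation ring, `J` is its maximal ideal and this is
the normalized discrete valuation, see `order_eq_addVal`. -/
noncomputable def order {B : Type*} [CommRing B] (b : B) : ℕ∞ :=
  ⨆ (m : ℕ) (_ : b ∈ Ring.jacobson B ^ m), (m : ℕ∞)

theorem order_eq_addVal {B : Type*} [CommRing B] [IsDomain B] [IsDiscreteValuationRing B] (b : B) :
    order b = IsDiscreteValuationRing.addVal B b := by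
  obtain ⟨ϖ, hϖ⟩ := IsDiscreteValuationRing.exists_irreducible B
  have key : ∀ m : ℕ, b ∈ Ring.jacobson B ^ m ↔
      (m : ℕ∞) ≤ IsDiscreteValuationRing.addVal B b := by
    intro m
    rw [IsLocalRing.ringJacobson_eq_maximalIdeal, hϖ.maximalIdeal_eq, Ideal.span_singleton_pow,
      Ideal.mem_span_singleton, ← IsDiscreteValuationRing.addVal_le_iff_dvd,
      AddValuation.map_pow, IsDiscreteValuationRing.addVal_uniformizer hϖ]
    simp
  unfold order
  simp only [key]
  apply le_antisymm
  · exact iSup₂_le fun m hm => hm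
  · refine ENat.forall_natCast_le_iff_le.mp ?_
    intro m hm
    exact le_iSup₂_of_le m hm le_rfl

/-- The value of an element `a` of a domain `A` with respect to the integral closure of `A` in its
field of fractions. For the ring of a branch of an algebroid curve this integral closure is a
discrete valuation ring. -/
noncomputable def normVal {A : Type*} [CommRing A] (a : A) : ℕ∞ :=
  order (algebraMap A (integralClosure A (FractionRing A)) a)

/-- `v_i(g)`, the value at the `i`-th branch of (the image in `𝒪_i` of) `g ∈ 𝒪`. -/
noncomputable def v {K : Type*} [Field K] {n r : ℕ} (P : Fin r → Ideal (PowerSeriesRing K n))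
    (i : Fin r) (g : LocalRing P) : ℕ∞ :=
  normVal (toBranch P i g)

/-- The `G`-product `G^α = ∏_{x ∈ G} x ^ α_x`. -/
noncomputable def gProd {K : Type*} [Field K] {n r : ℕ} {P : Fin r → Ideal (PowerSeriesRing K n)}
    (G : Finset (LocalRing P)) (α : LocalRing P → ℕ) : LocalRing P :=
  ∏ x ∈ G, x ^ α x

/-- `h` is a `k`-reduction of `g` modulo `G` (for `g ≠ 0` and `k ∈ I_g`, that is `v_k(g) ≠ ∞`). -/
def IsKReduction {K : Type*} [Field K] {n r : ℕ} (P : Fin r → Ideal (PowerSeriesRing K n))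
    (G : Finset (LocalRing P)) (k : Fin r) (g h : LocalRing P) : Prop :=
  g ≠ 0 ∧ v P k g ≠ ⊤ ∧
    ∃ (c : K) (α : LocalRing P → ℕ), h = g - c • gProd G α ∧
      (∀ i, v P i g ≤ v P i h) ∧ v P k g < v P k h

/-- `h` is a reduction of `g` modulo `G`. -/
def IsReduction {K : Type*} [Field K] {n r : ℕ} (P : Fin r → Ideal (PowerSeriesRing K n))
    (G : Finset (LocalRing P)) (g h : LocalRing P) : Prop :=
  ∃ k, IsKReduction P G k g h

/-- `g` admits a reduction modulo `G`. -/
def AdmitsReduction {K : Type*} [Field K] {n r : ℕ} (P : Fin r → Ideal (PowerSeriesRing K n))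
    (G : Finset (LocalRing P)) (g : LocalRing P) : Prop :=
  ∃ h, IsReduction P G g h

/-- `G` is a Standard Basis for `𝒪`: a nonempty finite subset of `ℳ ∖ {0}` modulo which every
nonzero element of `𝒪` has a reduction. -/
structure IsStandardBasis {K : Type*} [Field K] {n r : ℕ}
    (P : Fin r → Ideal (PowerSeriesRing K n)) (G : Finset (LocalRing P)) : Prop where
  nonempty : G.Nonempty
  mem_maxIdeal : ∀ x ∈ G, x ∈ maxIdeal P
  ne_zero : ∀ x ∈ G, x ≠ 0
  admitsReduction : ∀ g : LocalRing P, g ≠ 0 → AdmitsReduction P G g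

open Classical in
/-- A Standard Basis `G` is minimal if no `g ∈ G` has a reduction modulo `G ∖ {g}`. -/
structure IsMinimalStandardBasis {K : Type*} [Field K] {n r : ℕ}
    (P : Fin r → Ideal (PowerSeriesRing K n)) (G : Finset (LocalRing P)) : Prop where
  isStandardBasis : IsStandardBasis P G
  irreducible : ∀ g ∈ G, ¬ AdmitsReduction P (G.erase g) g

open Classical in
/-- `G'` arises from `G` by discarding one element `g ∈ G` that admits a reduction modulo
`G ∖ {g}`. -/
def DiscardStep {K : Type*} [Field K] {n r : ℕ} (P : Fin r → Ideal (PowerSeriesRing K n))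
    (G G' : Finset (LocalRing P)) : Prop :=
  ∃ g ∈ G, AdmitsReduction P (G.erase g) g ∧ G' = G.erase g

end AlgebroidCurve

/-! Each branch is finite over a ring `K[[x]]`, and the normalization of such a domain is a discrete
valuation ring with residue field `K`. Hence two elements with the same finite value at a branch
differ, after scaling one of them, by an element of larger value there. So `g` admits a reduction
modulo `G` iff some `G`-product has values at least those of `g`, with equality at some branch `k`
where `g` has finite value (`IsAttained`, `admitsReduction_iff`).

Modulo a Standard Basis the branch `k` can be prescribed (`isAttained_of_isStandardBasis`). As long
as equality at `k` fails, subtracting a multiple of the product raises another value of `f` and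
keeps the one at `k`. This stops, because a large finite value can be made infinite at once: by the
conductor, `f` agrees on that branch with an element vanishing on all the others (`exists_isolate`).

If `g ∈ G` is reducible modulo `G ∖ {g}`, then `g` is attained by products without `g` at every
branch where its value is finite (`isAttained_erase_self`). Substituting these for `g` in
`G`-products shows that `g` can be discarded (`isStandardBasis_erase`). Discards terminate by
cardinality.

A Standard Basis exists (`exists_isStandardBasis`) because there are finitely many value vectors
with bounded or infinite entries, while beyond the bound one isolates a branch and uses that
submonoids of `ℕ` are finitely generated. -/

/-! ### Completeness along a principal ideal, lifting of idempotents, rank bounds. -/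

theorem mem_span_singleton_pow_smul_top {R M : Type*} [CommRing R] [AddCommGroup M] [Module R M]
    (x : R) (n : ℕ) (m : M) :
    m ∈ (Ideal.span {x} ^ n • ⊤ : Submodule R M) ↔ ∃ y : M, m = x ^ n • y := by
  rw [Ideal.span_singleton_pow, Submodule.ideal_span_singleton_smul,
    Submodule.mem_smul_pointwise_iff_exists]
  simp [eq_comm]

theorem isPrecomplete_pi_span_singleton {R ι : Type*} [CommRing R] (x : R)
    [IsPrecomplete (Ideal.span {x}) R] : IsPrecomplete (Ideal.span {x}) (ι → R) := by
  refine isPrecomplete_iff.mpr fun f hf => ?_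
  have h1 : ∀ i, ∃ L : R, ∀ n, f n i ≡ L [SMOD (Ideal.span {x} ^ n • ⊤ : Submodule R R)] := by
    intro i
    refine IsPrecomplete.prec ‹_› (f := fun n => f n i) fun {m n} hmn => ?_
    have := hf hmn
    rw [SModEq.sub_mem, mem_span_singleton_pow_smul_top] at this ⊢
    obtain ⟨y, hy⟩ := this
    exact ⟨y i, by simpa using congrFun hy i⟩
  choose L hL using h1
  refine ⟨L, fun n => ?_⟩
  simp only [SModEq.sub_mem, mem_span_singleton_pow_smul_top] at hL ⊢
  choose y hy using hL
  exact ⟨fun i => y i n, by ext i; simpa using hy i n⟩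

theorem isPrecomplete_of_finite_span_singleton {R M : Type*} [CommRing R] [AddCommGroup M]
    [Module R M] (x : R) [IsPrecomplete (Ideal.span {x}) R] [Module.Finite R M] :
    IsPrecomplete (Ideal.span {x}) M := by
  obtain ⟨n, f, hf⟩ := Module.Finite.exists_fin' R M
  have := isPrecomplete_pi_span_singleton (ι := Fin n) x
  rw [← AdicCompletion.of_surjective_iff]
  intro y
  obtain ⟨z, rfl⟩ := AdicCompletion.map_surjective (Ideal.span {x}) hf y
  obtain ⟨w, rfl⟩ := AdicCompletion.of_surjective (Ideal.span {x}) _ z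
  exact ⟨f w, by rw [AdicCompletion.map_of]⟩

/-- Nakayama's lemma in its complete form: successive approximation takes the place of finiteness of
`M`. Both Noether normalization and finiteness of the normalization rest on it. -/
theorem Module.Finite.of_isHausdorff_span_singleton {R M : Type*} [CommRing R] [AddCommGroup M]
    [Module R M] (x : R) [IsPrecomplete (Ideal.span {x}) R] [IsHausdorff (Ideal.span {x}) M]
    [h : Module.Finite R (M ⧸ (Ideal.span {x} • ⊤ : Submodule R M))] : Module.Finite R M := by
  obtain ⟨n, f, hf⟩ := Module.Finite.exists_fin' R (M ⧸ (Ideal.span {x} • ⊤ : Submodule R M))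
  have := isPrecomplete_pi_span_singleton (ι := Fin n) x
  obtain ⟨g, hg⟩ := Module.projective_lifting_property
    (Submodule.mkQ (Ideal.span {x} • ⊤ : Submodule R M)) f (Submodule.mkQ_surjective _)
  refine Module.Finite.of_surjective g
    (surjective_of_mkQ_comp_surjective (I := Ideal.span {x}) ?_)
  rw [hg]
  exact hf

/-- Idempotents modulo `I` lift, so a domain that is `I`-adically complete and artinian modulo `I`
is local. -/
theorem IsLocalRing.of_isDomain_of_henselianRing {B : Type*} [CommRing B] [IsDomain B] (I : Ideal B)
    [HenselianRing B I] [IsArtinianRing (B ⧸ I)] : IsLocalRing B := by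
  have hjac := HenselianRing.jac (R := B) (I := I)
  refine IsLocalRing.of_isUnit_or_isUnit_one_sub_self fun a => ?_
  obtain ⟨k, u, hu⟩ := IsArtinian.exists_pow_succ_smul_dvd (Ideal.Quotient.mk I a) (1 : B ⧸ I)
  obtain ⟨u, rfl⟩ := Ideal.Quotient.mk_surjective u
  have h1 : a ^ (k + 1) * u - a ^ k ∈ I := by
    rw [← Ideal.Quotient.eq]; simpa using hu
  -- then `a ^ k` is divisible by every power of `a` modulo `I`
  have h2 : ∀ j, a ^ (k + j) * u ^ j - a ^ k ∈ I := by
    intro j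
    induction j with
    | zero => simp
    | succ j ih =>
      have : a ^ (k + (j + 1)) * u ^ (j + 1) - a ^ k =
        a ^ j * u ^ j * (a ^ (k + 1) * u - a ^ k) + (a ^ (k + j) * u ^ j - a ^ k) := by ring
      rw [this]
      exact I.add_mem (I.mul_mem_left _ h1) ih
  -- Stabilization of the powers of `a` makes `e` idempotent modulo `I`. Its lift is `0` or `1` in
  -- the domain `B`, which decides whether `1 - a` or `a` is a unit.
  set e := a ^ k * u ^ k with he
  have h3 : a ^ k * e - a ^ k ∈ I := by
    have := h2 k
    rw [he]; ring_nf at this ⊢; exact this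
  have h4 : e ^ 2 - e ∈ I := by
    have : e ^ 2 - e = u ^ k * (a ^ k * e - a ^ k) := by rw [he]; ring
    rw [this]; exact I.mul_mem_left _ h3
  -- The derivative `2e - 1` is its own inverse modulo `I`, since `(2e - 1)² - 1 = 4(e² - e)`.
  obtain ⟨f, hf, hfe⟩ := HenselianRing.is_henselian (I := I) (Polynomial.X ^ 2 - Polynomial.X : Polynomial B)
    (by monicity!) e (by simpa using h4) (by
      refine IsUnit.of_mul_eq_one (Ideal.Quotient.mk I (2 * e - 1)) ?_
      rw [← map_mul, ← map_one (Ideal.Quotient.mk I), Ideal.Quotient.eq]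
      have : (Polynomial.eval e (Polynomial.derivative (Polynomial.X ^ 2 - Polynomial.X :
        Polynomial B))) * (2 * e - 1) - 1 = 4 * (e ^ 2 - e) := by simp; ring
      rw [this]; exact I.mul_mem_left _ h4)
  have hf' : f * (f - 1) = 0 := by
    have : f ^ 2 - f = 0 := by simpa using hf
    linear_combination this
  rcases mul_eq_zero.mp hf' with h0 | h0
  · -- `a` is nilpotent modulo `I`
    right
    subst h0
    have heI : e ∈ I := by simpa using I.neg_mem hfe
    have hak : a ^ k ∈ I := by
      have := I.sub_mem (I.mul_mem_left (a ^ k) heI) h3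
      simpa using this
    have : IsUnit (1 - a ^ k) := by
      have := Ideal.mem_jacobson_bot.mp (hjac hak) (-1)
      simpa [sub_eq_neg_add] using this
    exact isUnit_of_dvd_unit (one_sub_dvd_one_sub_pow a k) this
  · left
    have h1f : f = 1 := sub_eq_zero.mp h0
    subst h1f
    -- For `k = 0` the element `e` is `1` and says nothing about `a`, but then `a * u` is `1` modulo
    -- `I`.
    rcases Nat.eq_zero_or_pos k with rfl | hk
    · have : IsUnit (1 + (a * u - 1) * 1) := by
        have := Ideal.mem_jacobson_bot.mp (hjac (by simpa using h1 : a * u - 1 ∈ I)) 1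
        simpa [add_comm] using this
      exact isUnit_of_dvd_unit ⟨u, by ring⟩ this
    · have : IsUnit e := by
        have := Ideal.mem_jacobson_bot.mp (hjac hfe) (-1)
        simpa using this
      exact isUnit_of_dvd_unit ((dvd_pow_self a hk.ne').trans ⟨u ^ k, rfl⟩) this

open TensorProduct in
/-- A flat module of bounded rank over a local ring is finite modulo the maximal ideal. -/
theorem IsLocalRing.finite_quotient_maximalIdeal_smul_top {R M : Type*} [CommRing R]
    [IsLocalRing R] [AddCommGroup M] [Module R M] [Module.Flat R M] (N : ℕ)
    (h : ∀ (k : ℕ) (w : Fin k → M), LinearIndependent R w → k ≤ N) :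
    Module.Finite R (M ⧸ (IsLocalRing.maximalIdeal R • ⊤ : Submodule R M)) := by
  have hsurj : Function.Surjective (TensorProduct.mk R (ResidueField R) M 1) :=
    TensorProduct.mk_surjective R M (ResidueField R) IsLocalRing.residue_surjective
  -- By flatness, lifts of residually independent elements are independent over `R`, so `N` bounds
  -- the residual rank as well.
  have hrank : Module.rank (ResidueField R) (ResidueField R ⊗[R] M) ≤ N := by
    refine _root_.rank_le fun s hs => ?_
    let w : Fin s.card → M := fun i => (hsurj (s.equivFin.symm i : ResidueField R ⊗[R] M)).choose
    have hw : ∀ i, TensorProduct.mk R (ResidueField R) M 1 (w i) = s.equivFin.symm i :=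
      fun i => (hsurj (s.equivFin.symm i : ResidueField R ⊗[R] M)).choose_spec
    refine h _ w (Module.IsLocalRing.linearIndependent_of_flat w ?_)
    have : TensorProduct.mk R (ResidueField R) M 1 ∘ w =
        (fun i : s => (i : ResidueField R ⊗[R] M)) ∘ s.equivFin.symm := funext hw
    rw [this]
    exact hs.comp _ s.equivFin.symm.injective
  have h1 : Module.Finite (ResidueField R) (ResidueField R ⊗[R] M) :=
    Module.rank_lt_aleph0_iff.mp (hrank.trans_lt (Cardinal.natCast_lt_aleph0))
  have h2 : Module.Finite R (ResidueField R) :=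
    Module.Finite.of_surjective (Algebra.linearMap R (ResidueField R)) IsLocalRing.residue_surjective
  have h3 : Module.Finite R (ResidueField R ⊗[R] M) := Module.Finite.trans (ResidueField R) _
  have h4 : Module.Finite R ((R ⧸ IsLocalRing.maximalIdeal R) ⊗[R] M) := h3
  exact Module.Finite.equiv (TensorProduct.quotTensorEquivQuotSMul M (IsLocalRing.maximalIdeal R))

/-! ### Normalization of a domain finite over a complete discrete valuation ring. -/

section FiniteExtension

variable {D A L : Type*} [CommRing D] [IsDomain D] [IsDiscreteValuationRing D] [CommRing A]
  [IsDomain A] [Field L] [Algebra D A] [FaithfulSMul D A] [Module.Finite D A] [Algebra A L]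
  [IsFractionRing A L] [Algebra D L] [IsScalarTower D A L]

omit [IsDiscreteValuationRing D] [FaithfulSMul D A] in
variable (A) in
theorem LinearIndependent.le_finrank_of_isFractionRing {k : ℕ} {w : Fin k → L}
    (hw : LinearIndependent D w) : k ≤ Module.finrank D A := by
  obtain ⟨b, hb⟩ := IsLocalization.exist_integer_multiples_of_finite (nonZeroDivisors A) w
  choose a ha using hb
  have hb0 : algebraMap A L b ≠ 0 := by
    simp
  have h1 : LinearIndependent D (fun i => algebraMap A L (a i)) := by
    have := hw.map' (LinearMap.mulLeft D (algebraMap A L b))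
      (LinearMap.ker_eq_bot.mpr (mul_right_injective₀ hb0))
    have h : (fun i => algebraMap A L (a i)) = LinearMap.mulLeft D (algebraMap A L b) ∘ w := by
      funext i
      simp [ha, Algebra.smul_def]
    rw [h]
    exact this
  have h2 : LinearIndependent D a :=
    LinearIndependent.of_comp ((IsScalarTower.toAlgHom D A L).toLinearMap) h1
  simpa using h2.fintype_card_le_finrank

omit [IsDomain D] [IsDiscreteValuationRing D] [IsDomain A] [Module.Finite D A] in
variable (D A L) in
theorem faithfulSMul_integralClosure : FaithfulSMul D (integralClosure A L) := by
  rw [faithfulSMul_iff_algebraMap_injective]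
  intro x y hxy
  have : algebraMap A L (algebraMap D A x) = algebraMap A L (algebraMap D A y) := by
    rw [← IsScalarTower.algebraMap_apply, ← IsScalarTower.algebraMap_apply]
    exact congrArg Subtype.val hxy
  exact FaithfulSMul.algebraMap_injective D A (IsFractionRing.injective A L this)

omit [IsDomain D] [IsDiscreteValuationRing D] [IsDomain A] [FaithfulSMul D A]
  [IsFractionRing A L] in
variable (D A L) in
theorem isIntegral_integralClosure : Algebra.IsIntegral D (integralClosure A L) := by
  have : Algebra.IsIntegral D A := inferInstance
  exact Algebra.IsIntegral.trans A

omit [IsDomain A] in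
variable (A L) in
-- A nonzero integral element `b` has a nonzero multiple in `D`, of the form `u * ϖ ^ e`.
-- Divisibility of `b` by `ϖ ^ (e + 1)` would make `ϖ` a unit in the integral closure, hence in `D`.
theorem isHausdorff_integralClosure {ϖ : D} (hϖ : Irreducible ϖ) :
    IsHausdorff (Ideal.span {ϖ}) (integralClosure A L) := by
  have := faithfulSMul_integralClosure D A L
  have := isIntegral_integralClosure D A L
  refine ⟨fun b hb => by_contra fun hb0 => ?_⟩
  simp only [SModEq.sub_mem, sub_zero, mem_span_singleton_pow_smul_top] at hb
  have h1 := Ideal.comap_ne_bot_of_integral_mem (R := D) (I := Ideal.span {b}) hb0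
    (Ideal.mem_span_singleton_self b) (Algebra.IsIntegral.isIntegral b)
  obtain ⟨d, hd, hd0⟩ := Submodule.exists_mem_ne_zero_of_ne_bot h1
  obtain ⟨c, hc⟩ := Ideal.mem_span_singleton.mp (Ideal.mem_comap.mp hd)
  obtain ⟨e, u, rfl⟩ := IsDiscreteValuationRing.eq_unit_mul_pow_irreducible hd0 hϖ
  obtain ⟨y, hy⟩ := hb (e + 1)
  have hϖB : algebraMap D (integralClosure A L) ϖ ≠ 0 := by
    rw [Ne, FaithfulSMul.algebraMap_eq_zero_iff]; exact hϖ.ne_zero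
  rw [hy, Algebra.smul_def, map_mul, map_pow, map_pow] at hc
  have h2 : algebraMap D (integralClosure A L) ϖ * (y * c) = algebraMap D (integralClosure A L) u :=
    mul_left_cancel₀ (pow_ne_zero e hϖB) (by linear_combination -hc)
  have h3 : IsUnit (algebraMap D (integralClosure A L) ϖ) :=
    isUnit_of_mul_isUnit_left (h2 ▸ u.isUnit.map _)
  exact hϖ.not_isUnit (isUnit_of_map_unit (algebraMap D (integralClosure A L)) _ h3)

variable (A L) in
/-- A complete discrete valuation ring is Japanese. -/
theorem finite_integralClosure_of_isAdicComplete {ϖ : D} (hϖ : Irreducible ϖ)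
    [IsAdicComplete (Ideal.span {ϖ}) D] : Module.Finite D (integralClosure A L) := by
  have := faithfulSMul_integralClosure D A L
  have := isHausdorff_integralClosure A L hϖ
  have htf : Module.IsTorsionFree D (integralClosure A L) := inferInstance
  -- The rank bound comes from `L` alone; no trace form is involved, so inseparable extensions are
  -- covered.
  have := IsLocalRing.finite_quotient_maximalIdeal_smul_top (R := D) (M := integralClosure A L)
    (Module.finrank D A) fun k w hw => by
      refine LinearIndependent.le_finrank_of_isFractionRing A (L := L)
        (w := fun i => (w i : L)) ?_
      exact hw.map' (((integralClosure A L).val.restrictScalars D).toLinearMap)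
        (LinearMap.ker_eq_bot.mpr Subtype.val_injective)
  rw [hϖ.maximalIdeal_eq] at this
  exact Module.Finite.of_isHausdorff_span_singleton ϖ

variable (A L) in
-- Finiteness over `D` makes the integral closure noetherian and `ϖ`-adically complete, hence
-- Henselian along `ϖ`. It is artinian modulo `ϖ`, so idempotent lifting makes it local; a local
-- Dedekind domain that is not a field is a discrete valuation ring.
theorem isDiscreteValuationRing_integralClosure {ϖ : D} (hϖ : Irreducible ϖ)
    [IsAdicComplete (Ideal.span {ϖ}) D] : IsDiscreteValuationRing (integralClosure A L) := by
  have := faithfulSMul_integralClosure D A L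
  have := isIntegral_integralClosure D A L
  have hfin := finite_integralClosure_of_isAdicComplete A L hϖ
  have := isHausdorff_integralClosure A L hϖ
  have : IsPrecomplete (Ideal.span {ϖ}) (integralClosure A L) :=
    isPrecomplete_of_finite_span_singleton ϖ
  have : IsAdicComplete (Ideal.span {ϖ}) (integralClosure A L) := {}
  have : IsAdicComplete ((Ideal.span {ϖ}).map (algebraMap D (integralClosure A L)))
    (integralClosure A L) :=
    { IsHausdorff.map_algebraMap_iff.mpr this.toIsHausdorff,
      IsPrecomplete.map_algebraMap_iff.mpr this.toIsPrecomplete with }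
  set I := (Ideal.span {ϖ}).map (algebraMap D (integralClosure A L)) with hI
  have hnoeth : IsNoetherianRing (integralClosure A L) := IsNoetherianRing.of_finite D _
  have hdim : Ring.DimensionLEOne (integralClosure A L) := Ring.DimensionLEOne.of_isIntegral D _
  have hϖB : algebraMap D (integralClosure A L) ϖ ≠ 0 := by
    rw [Ne, FaithfulSMul.algebraMap_eq_zero_iff]; exact hϖ.ne_zero
  have hI0 : I ≠ ⊥ := by
    rw [hI, Ideal.map_span, Set.image_singleton, Ne, Ideal.span_singleton_eq_bot]
    exact hϖB
  have : IsArtinianRing (integralClosure A L ⧸ I) := by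
    have : Ring.KrullDimLE 0 (integralClosure A L ⧸ I) := by
      refine Ring.KrullDimLE.mk₀ fun p hp => ?_
      have hle : I ≤ p.comap (Ideal.Quotient.mk I) := fun x hx => by
        rw [Ideal.mem_comap, Ideal.Quotient.eq_zero_iff_mem.mpr hx]
        exact p.zero_mem
      have hmax := hdim.maximalOfPrime (ne_bot_of_le_ne_bot hI0 hle) (p.comap_isPrime _)
      have h := Ideal.map_eq_top_or_isMaximal_of_surjective (Ideal.Quotient.mk I)
        Ideal.Quotient.mk_surjective hmax
      rw [Ideal.map_comap_of_surjective _ Ideal.Quotient.mk_surjective] at h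
      exact h.resolve_left hp.ne_top
    exact isArtinianRing_iff_isNoetherianRing_krullDimLE_zero.mpr ⟨inferInstance, this⟩
  have : IsLocalRing (integralClosure A L) := IsLocalRing.of_isDomain_of_henselianRing I
  have : Algebra.IsAlgebraic A L := 
    (IsFractionRing.comap_isAlgebraic_iff (A := A) (K := L) (C := L)).mpr inferInstance
  have : IsFractionRing (integralClosure A L) L :=
    integralClosure.isFractionRing_of_algebraic (by simp)
  have : IsDedekindDomain (integralClosure A L) := by
    refine (isDedekindDomain_iff (integralClosure A L) L).mpr ⟨inferInstance, hnoeth, hdim, ?_⟩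
    intro x hx
    exact ⟨⟨x, isIntegral_trans x hx⟩, rfl⟩
  have hfield : ¬ IsField (integralClosure A L) := by
    intro hF
    have : IsUnit (algebraMap D (integralClosure A L) ϖ) := by
      obtain ⟨y, hy⟩ := hF.mul_inv_cancel hϖB
      exact .of_mul_eq_one _ hy
    exact hϖ.not_isUnit (isUnit_of_map_unit (algebraMap D (integralClosure A L)) _ this)
  exact ((IsDiscreteValuationRing.TFAE (integralClosure A L) hfield).out 0 2).mpr this

end FiniteExtension

/-! ### Conductor, residue field, and finiteness modulo powers of the maximal ideal. -/

/-- The conductor of a domain in its normalization bounds divisibility by the valuation. -/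
theorem exists_natCast_le_addVal_imp_dvd {A L : Type*} [CommRing A] [IsDomain A] [Field L]
    [Algebra A L] [IsFractionRing A L] [Module.Finite A (integralClosure A L)]
    [IsDiscreteValuationRing (integralClosure A L)] {t : A} (ht : t ≠ 0) :
    ∃ N : ℕ, ∀ f : A, (N : ℕ∞) ≤ IsDiscreteValuationRing.addVal (integralClosure A L)
      (algebraMap A (integralClosure A L) f) → t ∣ f := by
  obtain ⟨s, hs⟩ := Module.Finite.fg_top (R := A) (M := integralClosure A L)
  classical
  -- A common denominator `b` of module generators lies in the conductor: it carries the whole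
  -- normalization into `A`. The bound `N` is then the value of `t * b`.
  obtain ⟨b, hb⟩ := IsLocalization.exist_integer_multiples_of_finset (nonZeroDivisors A)
    (s.image (fun y : integralClosure A L => (y : L)))
  have hb' : ∀ y : integralClosure A L, ∃ a : A, algebraMap A L a = (b : A) • (y : L) := by
    intro y
    have hy : y ∈ Submodule.span A (s : Set (integralClosure A L)) := hs ▸ Submodule.mem_top
    induction hy using Submodule.span_induction with
    | mem y hy => exact hb y (Finset.mem_image_of_mem _ hy)
    | zero => exact ⟨0, by simp⟩
    | add y z _ _ ihy ihz =>
      obtain ⟨a, ha⟩ := ihy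
      obtain ⟨c, hc⟩ := ihz
      exact ⟨a + c, by simp [ha, hc]⟩
    | smul r y _ ihy =>
      obtain ⟨a, ha⟩ := ihy
      exact ⟨r * a, by simp [ha, Algebra.smul_def]; ring⟩
  have hinj : Function.Injective (algebraMap A (integralClosure A L)) :=
    FaithfulSMul.algebraMap_injective A _
  have hne : algebraMap A (integralClosure A L) (t * b) ≠ 0 := by
    rw [Ne, map_eq_zero_iff _ hinj]
    exact mul_ne_zero ht (nonZeroDivisors.ne_zero b.2)
  obtain ⟨N, hN⟩ := ENat.ne_top_iff_exists.mp
    ((IsDiscreteValuationRing.addVal_eq_top_iff (R := integralClosure A L)).not.mpr hne)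
  refine ⟨N, fun f hf => ?_⟩
  rw [hN, IsDiscreteValuationRing.addVal_le_iff_dvd] at hf
  obtain ⟨y, hy⟩ := hf
  obtain ⟨a, ha⟩ := hb' y
  refine ⟨a, IsFractionRing.injective A L ?_⟩
  have := congrArg (fun z : integralClosure A L => (z : L)) hy
  have h2 : algebraMap A L f = algebraMap A L (t * b) * y := this
  rw [h2, map_mul, map_mul, ha, Algebra.smul_def, mul_assoc]

/-- The residue field of `B` is integral over `K`, because `X` dies in it, and so equals `K`. -/
theorem exists_not_isUnit_sub_algebraMap {K B : Type*} [Field K] [IsAlgClosed K] [CommRing B]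
    [IsLocalRing B] [Algebra (PowerSeries K) B] [Algebra.IsIntegral (PowerSeries K) B]
    [FaithfulSMul (PowerSeries K) B] (u : B) :
    ∃ c : K, ¬ IsUnit (u - algebraMap (PowerSeries K) B (PowerSeries.C c)) := by
  let ψ : PowerSeries K →+* IsLocalRing.ResidueField B :=
    (IsLocalRing.residue B).comp (algebraMap (PowerSeries K) B)
  have hX : ψ PowerSeries.X = 0 := by
    rw [RingHom.comp_apply, IsLocalRing.residue_eq_zero_iff, IsLocalRing.mem_maximalIdeal,
      mem_nonunits_iff]
    intro h
    exact PowerSeries.X_prime.not_isUnit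
      (isUnit_of_map_unit (algebraMap (PowerSeries K) B) _ h)
  have hψ : ψ = (ψ.comp (PowerSeries.C (R := K))).comp (PowerSeries.constantCoeff (R := K)) := by
    ext f
    obtain ⟨g, hg⟩ := PowerSeries.X_dvd_iff.mpr
      (show PowerSeries.constantCoeff (f - PowerSeries.C (PowerSeries.constantCoeff f)) = 0 by simp)
    have := congrArg ψ hg
    rw [map_sub, map_mul, hX, zero_mul, sub_eq_zero] at this
    exact this
  let : Algebra K (IsLocalRing.ResidueField B) := (ψ.comp (PowerSeries.C (R := K))).toAlgebra
  have : Algebra.IsIntegral K (IsLocalRing.ResidueField B) := by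
    refine ⟨fun y => ?_⟩
    obtain ⟨y, rfl⟩ := IsLocalRing.residue_surjective y
    obtain ⟨p, hp, hpy⟩ := Algebra.IsIntegral.isIntegral (R := PowerSeries K) y
    refine ⟨p.map (PowerSeries.constantCoeff (R := K)), hp.map _, ?_⟩
    rw [Polynomial.eval₂_map]
    change Polynomial.eval₂ ((ψ.comp (PowerSeries.C (R := K))).comp
      (PowerSeries.constantCoeff (R := K))) _ p = 0
    rw [← hψ, ← Polynomial.hom_eval₂, hpy, map_zero]
  obtain ⟨c, hc⟩ := (IsAlgClosed.algebraMap_bijective_of_isIntegral (k := K)).2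
    (IsLocalRing.residue B u)
  refine ⟨c, ?_⟩
  rw [← mem_nonunits_iff, ← IsLocalRing.mem_maximalIdeal, ← IsLocalRing.residue_eq_zero_iff,
    map_sub, ← hc, sub_eq_zero]
  rfl

/-- Cancellation of leading terms: if `a = b * u` and `ι c` has the residue of `u`, then `b * (u - ι
c)` has larger value than `b`. -/
theorem IsDiscreteValuationRing.exists_addVal_lt_addVal_sub {B : Type*} [CommRing B] [IsDomain B]
    [IsDiscreteValuationRing B] {K : Type*} (ι : K → B) (hι : ∀ u : B, ∃ c, ¬ IsUnit (u - ι c))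
    {a b : B} (hab : addVal B a = addVal B b) (ha : addVal B a ≠ ⊤) :
    ∃ c, addVal B a < addVal B (a - ι c * b) := by
  obtain ⟨u, rfl⟩ := (addVal_le_iff_dvd).mp hab.ge
  obtain ⟨c, hc⟩ := hι u
  refine ⟨c, ?_⟩
  have h1 : b * u - ι c * b = b * (u - ι c) := by ring
  rw [h1, hab, addVal_mul]
  have h2 : addVal B (u - ι c) ≠ 0 := fun h => hc (addVal_eq_zero_iff.mp h)
  rw [add_comm]
  exact ENat.lt_add_left (hab ▸ ha) (pos_iff_ne_zero.mpr h2)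

/-- If the residue field of a noetherian local ring `A` is `K`, then `A / 𝔪 ^ k` is finite
over `K`. -/
theorem IsLocalRing.exists_fg_sub_mem_maximalIdeal_pow {K A : Type*} [Field K] [CommRing A]
    [IsLocalRing A] [IsNoetherianRing A] [Algebra K A]
    (hK : ∀ a : A, ∃ c : K, a - algebraMap K A c ∈ maximalIdeal A) (k : ℕ) :
    ∃ V : Submodule K A, V.FG ∧ ∀ a : A, ∃ w ∈ V, a - w ∈ maximalIdeal A ^ k := by
  induction k with
  | zero => exact ⟨⊥, Submodule.fg_bot, fun a => ⟨0, Submodule.zero_mem _, by simp⟩⟩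
  | succ k ih =>
    obtain ⟨V, hV, hVa⟩ := ih
    obtain ⟨N, g, hg⟩ := Submodule.fg_iff_exists_fin_generating_family.mp
      ((maximalIdeal A).fg_of_isNoetherianRing)
    -- An element is a constant plus a combination of the generators `g i` of the maximal ideal;
    -- approximating the coefficients from `V` gains one order.
    refine ⟨Submodule.span K {1} ⊔ V * Submodule.span K (Set.range g),
      (Submodule.fg_span_singleton _).sup (hV.mul (Submodule.fg_span (Set.finite_range g))), ?_⟩
    intro a
    obtain ⟨c, hc⟩ := hK a
    rw [← hg, Submodule.mem_span_range_iff_exists_fun] at hc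
    obtain ⟨r, hr⟩ := hc
    choose w hwV hw using fun i => hVa (r i)
    refine ⟨c • 1 + ∑ i, w i * g i, Submodule.add_mem_sup
      (Submodule.smul_mem _ _ (Submodule.mem_span_singleton_self _))
      (Submodule.sum_mem _ fun i _ => Submodule.mul_mem_mul (hwV i)
        (Submodule.subset_span ⟨i, rfl⟩)), ?_⟩
    have : a - (c • 1 + ∑ i, w i * g i) = ∑ i, (r i - w i) * g i := by
      simp only [sub_mul, Finset.sum_sub_distrib]
      simp only [smul_eq_mul] at hr
      rw [hr, Algebra.algebraMap_eq_smul_one]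
      ring
    rw [this, pow_succ]
    refine Ideal.sum_mem _ fun i _ => Ideal.mul_mem_mul (hw i) ?_
    rw [← hg]
    exact Submodule.subset_span ⟨i, rfl⟩

theorem IsLocalRing.exists_maximalIdeal_pow_le_span_singleton {A : Type*} [CommRing A] [IsDomain A]
    [IsLocalRing A] [IsNoetherianRing A] (hA : ringKrullDim A = 1) {x : A} (hx : x ≠ 0) :
    ∃ k, maximalIdeal A ^ k ≤ Ideal.span {x} := by
  have hdim : Ring.KrullDimLE 1 A := Ring.krullDimLE_iff.mpr (by rw [hA]; rfl)
  rw [Ring.krullDimLE_one_iff_of_isPrime_bot] at hdim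
  have hrad : maximalIdeal A ≤ (Ideal.span {x}).radical := by
    rw [Ideal.radical_eq_sInf]
    refine le_sInf fun p hp => ?_
    have hp0 : p ≠ ⊥ := by
      rintro rfl
      exact hx (by simpa using hp.1)
    have := hp.2
    exact (eq_maximalIdeal (hdim p hp0 hp.2)).ge
  obtain ⟨k, hk⟩ := (Ideal.span {x}).exists_radical_pow_le_of_fg
    ((Ideal.span {x}).radical.fg_of_isNoetherianRing)
  exact ⟨k, (Ideal.pow_right_mono hrad k).trans hk⟩

/-! ### A single branch: Noether normalization and its valuation. -/

namespace AlgebroidCurve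

section Branch

variable {K : Type*} [Field K] {n : ℕ} (P : Ideal (PowerSeriesRing K n)) [hP : P.IsPrime]

omit hP in
theorem sub_C_constantCoeff_mem_maximalIdeal (f : PowerSeriesRing K n) :
    f - MvPowerSeries.C (MvPowerSeries.constantCoeff f) ∈
      IsLocalRing.maximalIdeal (PowerSeriesRing K n) := by
  rw [IsLocalRing.mem_maximalIdeal, mem_nonunits_iff, MvPowerSeries.isUnit_iff_constantCoeff]
  simp

omit hP in
theorem smul_quotient_eq_algebraMap_mul (c : K) (a : PowerSeriesRing K n ⧸ P) :
    c • a = algebraMap K (PowerSeriesRing K n ⧸ P) c * a := by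
  obtain ⟨f, rfl⟩ := Ideal.Quotient.mk_surjective a
  exact congrArg (Ideal.Quotient.mk P) (Algebra.smul_def c f)

instance : IsLocalRing (PowerSeriesRing K n ⧸ P) :=
  IsLocalRing.of_surjective' (Ideal.Quotient.mk P) Ideal.Quotient.mk_surjective

theorem exists_sub_algebraMap_mem_maximalIdeal (a : PowerSeriesRing K n ⧸ P) :
    ∃ c : K, a - algebraMap K _ c ∈ IsLocalRing.maximalIdeal (PowerSeriesRing K n ⧸ P) := by
  obtain ⟨f, rfl⟩ := Ideal.Quotient.mk_surjective a
  have hloc := IsLocalHom.of_surjective (Ideal.Quotient.mk P) Ideal.Quotient.mk_surjective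
  refine ⟨MvPowerSeries.constantCoeff f, ?_⟩
  have h := sub_C_constantCoeff_mem_maximalIdeal f
  have : Ideal.Quotient.mk P f - algebraMap K _ (MvPowerSeries.constantCoeff f) =
    Ideal.Quotient.mk P (f - MvPowerSeries.C (MvPowerSeries.constantCoeff f)) := by
      rw [map_sub]; rfl
  rw [this]
  exact map_nonunit _ _ h

/-- Noether normalization for a branch: it is finite over a ring of power series in one variable. -/
theorem exists_finite_powerSeries_algHom (hdim : ringKrullDim (PowerSeriesRing K n ⧸ P) = 1) :
    ∃ φ : PowerSeries K →ₐ[K] PowerSeriesRing K n ⧸ P,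
      Function.Injective φ ∧ (φ : PowerSeries K →+* PowerSeriesRing K n ⧸ P).Finite := by
  have hfield : ¬ IsField (PowerSeriesRing K n ⧸ P) := fun h => by
    rw [ringKrullDim_eq_zero_of_isField h] at hdim
    exact zero_ne_one hdim
  obtain ⟨x, hx, hx0⟩ := Submodule.exists_mem_ne_zero_of_ne_bot
    (IsLocalRing.isField_iff_maximalIdeal_eq.not.mp hfield)
  obtain ⟨f, rfl⟩ := Ideal.Quotient.mk_surjective x
  have hf : MvPowerSeries.constantCoeff f = 0 := by
    by_contra h
    rw [IsLocalRing.mem_maximalIdeal, mem_nonunits_iff] at hx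
    exact hx ((MvPowerSeries.isUnit_iff_constantCoeff.mpr (Ne.isUnit h)).map _)
  have hsubst := PowerSeries.HasSubst.of_constantCoeff_zero hf
  -- `X` goes to a nonzero element of the maximal ideal. Injectivity follows since a nonzero series
  -- is a unit times a power of `X` and the target is a domain.
  let φ : PowerSeries K →ₐ[K] PowerSeriesRing K n ⧸ P :=
    (Ideal.Quotient.mkₐ K P).comp (PowerSeries.substAlgHom hsubst)
  have hφX : φ PowerSeries.X = Ideal.Quotient.mk P f := by
    simp only [φ, AlgHom.comp_apply, PowerSeries.substAlgHom_X]
    rfl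
  have hinj : Function.Injective φ := by
    rw [injective_iff_map_eq_zero]
    intro g hg
    by_contra hg0
    obtain ⟨e, u, rfl⟩ := IsDiscreteValuationRing.eq_unit_mul_pow_irreducible hg0
      PowerSeries.X_irreducible
    rw [map_mul, map_pow, hφX] at hg
    exact (mul_ne_zero (u.isUnit.map φ).ne_zero (pow_ne_zero e hx0)) hg
  refine ⟨φ, hinj, ?_⟩
  let : Algebra (PowerSeries K) (PowerSeriesRing K n ⧸ P) := (φ : PowerSeries K →+* _).toAlgebra
  have hmap : (Ideal.span {PowerSeries.X}).map
      (algebraMap (PowerSeries K) (PowerSeriesRing K n ⧸ P)) =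
      Ideal.span {Ideal.Quotient.mk P f} := by
    rw [Ideal.map_span, Set.image_singleton, ← hφX]
    rfl
  have : IsHausdorff (Ideal.span {(PowerSeries.X : PowerSeries K)}) (PowerSeriesRing K n ⧸ P) := by
    refine IsHausdorff.of_map (J := IsLocalRing.maximalIdeal (PowerSeriesRing K n ⧸ P)) ?_
    rw [hmap, Ideal.span_singleton_le_iff_mem]
    exact hx
  -- In dimension one the image of `X` generates an ideal containing a power of the maximal ideal.
  -- So the quotient by it is spanned over `K` by finitely many classes, and complete Nakayama
  -- applies.
  obtain ⟨k, hk⟩ := IsLocalRing.exists_maximalIdeal_pow_le_span_singleton hdim hx0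
  obtain ⟨V, ⟨s, hs⟩, hV⟩ := IsLocalRing.exists_fg_sub_mem_maximalIdeal_pow
    (exists_sub_algebraMap_mem_maximalIdeal P) k
  have : Module.Finite (PowerSeries K) ((PowerSeriesRing K n ⧸ P) ⧸
      (Ideal.span {(PowerSeries.X : PowerSeries K)} • ⊤ :
        Submodule (PowerSeries K) (PowerSeriesRing K n ⧸ P))) := by
    classical
    refine ⟨⟨s.image (Submodule.mkQ _), ?_⟩⟩
    rw [eq_top_iff, Finset.coe_image, ← Submodule.map_span]
    rintro y -
    obtain ⟨a, rfl⟩ := Submodule.mkQ_surjective _ y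
    obtain ⟨w, hwV, hw⟩ := hV a
    have hwD : w ∈ Submodule.span (PowerSeries K) (s : Set (PowerSeriesRing K n ⧸ P)) := by
      rw [← hs] at hwV
      clear hw
      induction hwV using Submodule.span_induction with
      | mem w hw => exact Submodule.subset_span hw
      | zero => exact Submodule.zero_mem _
      | add v w _ _ hv hw => exact Submodule.add_mem _ hv hw
      | smul c w _ hw =>
        have : c • w = (PowerSeries.C c : PowerSeries K) • w := by
          rw [smul_quotient_eq_algebraMap_mul, Algebra.smul_def, ← φ.commutes]
          rfl
        rw [this]
        exact Submodule.smul_mem _ _ hw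
    refine ⟨w, hwD, ?_⟩
    rw [← sub_eq_zero, ← map_sub, Submodule.mkQ_apply, Submodule.Quotient.mk_eq_zero,
      Ideal.smul_top_eq_map, Submodule.restrictScalars_mem, hmap, ← neg_sub]
    exact Ideal.neg_mem_iff _ |>.mpr (hk hw)
  have : Module.Finite (PowerSeries K) (PowerSeriesRing K n ⧸ P) :=
    Module.Finite.of_isHausdorff_span_singleton PowerSeries.X
  exact this

theorem isDiscreteValuationRing_integralClosure_branch
    (hdim : ringKrullDim (PowerSeriesRing K n ⧸ P) = 1) :
    IsDiscreteValuationRing (integralClosure (PowerSeriesRing K n ⧸ P)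
      (FractionRing (PowerSeriesRing K n ⧸ P))) := by
  obtain ⟨φ, hφ, hfin⟩ := exists_finite_powerSeries_algHom P hdim
  let : Algebra (PowerSeries K) (PowerSeriesRing K n ⧸ P) := (φ : PowerSeries K →+* _).toAlgebra
  have : Module.Finite (PowerSeries K) (PowerSeriesRing K n ⧸ P) := hfin
  have : FaithfulSMul (PowerSeries K) (PowerSeriesRing K n ⧸ P) :=
    (faithfulSMul_iff_algebraMap_injective _ _).mpr hφ
  exact isDiscreteValuationRing_integralClosure _ _ (PowerSeries.X_irreducible (R := K))

theorem exists_natCast_le_normVal_imp_dvd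
    (hdim : ringKrullDim (PowerSeriesRing K n ⧸ P) = 1) {t : PowerSeriesRing K n ⧸ P}
    (ht : t ≠ 0) : ∃ N : ℕ, ∀ f, (N : ℕ∞) ≤ normVal f → t ∣ f := by
  have := isDiscreteValuationRing_integralClosure_branch P hdim
  obtain ⟨φ, hφ, hfin⟩ := exists_finite_powerSeries_algHom P hdim
  let : Algebra (PowerSeries K) (PowerSeriesRing K n ⧸ P) := (φ : PowerSeries K →+* _).toAlgebra
  have : Module.Finite (PowerSeries K) (PowerSeriesRing K n ⧸ P) := hfin
  have : FaithfulSMul (PowerSeries K) (PowerSeriesRing K n ⧸ P) :=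
    (faithfulSMul_iff_algebraMap_injective _ _).mpr hφ
  have : Module.Finite (PowerSeries K) (integralClosure (PowerSeriesRing K n ⧸ P)
      (FractionRing (PowerSeriesRing K n ⧸ P))) :=
    finite_integralClosure_of_isAdicComplete _ _ (PowerSeries.X_irreducible (R := K))
  have : Module.Finite (PowerSeriesRing K n ⧸ P) (integralClosure (PowerSeriesRing K n ⧸ P)
      (FractionRing (PowerSeriesRing K n ⧸ P))) := .of_restrictScalars_finite (PowerSeries K) _ _
  obtain ⟨N, hN⟩ := exists_natCast_le_addVal_imp_dvd
    (L := FractionRing (PowerSeriesRing K n ⧸ P)) ht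
  exact ⟨N, fun f hf => hN f (by rwa [normVal, order_eq_addVal] at hf)⟩

theorem exists_normVal_lt_normVal_sub [IsAlgClosed K]
    (hdim : ringKrullDim (PowerSeriesRing K n ⧸ P) = 1) {a b : PowerSeriesRing K n ⧸ P}
    (hab : normVal a = normVal b) (ha : normVal a ≠ ⊤) :
    ∃ c : K, normVal a < normVal (a - c • b) := by
  have := isDiscreteValuationRing_integralClosure_branch P hdim
  obtain ⟨φ, hφ, hfin⟩ := exists_finite_powerSeries_algHom P hdim
  let : Algebra (PowerSeries K) (PowerSeriesRing K n ⧸ P) := (φ : PowerSeries K →+* _).toAlgebra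
  have : Module.Finite (PowerSeries K) (PowerSeriesRing K n ⧸ P) := hfin
  have : FaithfulSMul (PowerSeries K) (PowerSeriesRing K n ⧸ P) :=
    (faithfulSMul_iff_algebraMap_injective _ _).mpr hφ
  have := isIntegral_integralClosure (PowerSeries K) (PowerSeriesRing K n ⧸ P)
    (FractionRing (PowerSeriesRing K n ⧸ P))
  have := faithfulSMul_integralClosure (PowerSeries K) (PowerSeriesRing K n ⧸ P)
    (FractionRing (PowerSeriesRing K n ⧸ P))
  simp only [normVal, order_eq_addVal] at hab ha ⊢
  obtain ⟨c, hc⟩ := IsDiscreteValuationRing.exists_addVal_lt_addVal_sub _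
    (exists_not_isUnit_sub_algebraMap (K := K)) hab ha
  refine ⟨c, ?_⟩
  have h : algebraMap (PowerSeriesRing K n ⧸ P) (integralClosure (PowerSeriesRing K n ⧸ P)
      (FractionRing (PowerSeriesRing K n ⧸ P))) (c • b) =
      algebraMap (PowerSeries K) _ (PowerSeries.C c) * algebraMap _ _ b := by
    rw [smul_quotient_eq_algebraMap_mul, map_mul, ← φ.commutes]
    rfl
  rw [map_sub, h]
  exact hc

end Branch

section NormVal

variable {A : Type*} [CommRing A] [IsDomain A]
  [IsDiscreteValuationRing (integralClosure A (FractionRing A))]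

theorem normVal_mul (a b : A) : normVal (a * b) = normVal a + normVal b := by
  simp only [normVal, order_eq_addVal, map_mul, IsDiscreteValuationRing.addVal_mul]

theorem min_normVal_le_normVal_add (a b : A) :
    min (normVal a) (normVal b) ≤ normVal (a + b) := by
  simp only [normVal, order_eq_addVal, map_add]
  exact IsDiscreteValuationRing.addVal_add

theorem normVal_eq_top_iff {a : A} : normVal a = ⊤ ↔ a = 0 := by
  simp only [normVal, order_eq_addVal, IsDiscreteValuationRing.addVal_eq_top_iff]
  exact map_eq_zero_iff _ (FaithfulSMul.algebraMap_injective A _)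

theorem normVal_eq_zero_iff {a : A} : normVal a = 0 ↔ IsUnit a := by
  simp only [normVal, order_eq_addVal, IsDiscreteValuationRing.addVal_eq_zero_iff]
  exact isUnit_map_iff _ _

theorem normVal_neg (a : A) : normVal (-a) = normVal a := by
  have h : normVal (-1 : A) = 0 := normVal_eq_zero_iff.mpr isUnit_one.neg
  rw [← neg_one_mul, normVal_mul, h, zero_add]

end NormVal

end AlgebroidCurve

/-! ### The values `v P i` on the curve and the isolation of branches. -/

namespace AlgebroidCurve

/-- A strictly larger prime `q` would be a nonzero prime of the one-dimensional domain `R ⧸ p`,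
hence maximal, and `R ⧸ q` would have dimension zero. -/
theorem le_imp_eq_of_ringKrullDim_quotient_eq_one {R : Type*} [CommRing R] {p q : Ideal R}
    [p.IsPrime] [q.IsPrime] (hp : ringKrullDim (R ⧸ p) = 1) (hq : ringKrullDim (R ⧸ q) = 1)
    (hpq : p ≤ q) : p = q := by
  by_contra hne
  have hdim : Ring.KrullDimLE 1 (R ⧸ p) := Ring.krullDimLE_iff.mpr (by rw [hp]; rfl)
  rw [Ring.krullDimLE_one_iff_of_isPrime_bot] at hdim
  have hker : RingHom.ker (Ideal.Quotient.mk p) ≤ q := by rwa [Ideal.mk_ker]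
  have hprime := Ideal.map_isPrime_of_surjective (f := Ideal.Quotient.mk p)
    Ideal.Quotient.mk_surjective hker
  have hcomap : (q.map (Ideal.Quotient.mk p)).comap (Ideal.Quotient.mk p) = q := by
    rw [Ideal.comap_map_of_surjective _ Ideal.Quotient.mk_surjective]
    exact sup_eq_left.mpr hker
  have hbot : q.map (Ideal.Quotient.mk p) ≠ ⊥ := fun h => by
    rw [h] at hcomap
    change RingHom.ker _ = _ at hcomap
    rw [Ideal.mk_ker] at hcomap
    exact hne hcomap
  have hmax := hdim _ hbot hprime
  have hqmax : q.IsMaximal := by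
    rw [← hcomap]
    exact Ideal.comap_isMaximal_of_surjective _ Ideal.Quotient.mk_surjective
  have hfield := (Ideal.Quotient.maximal_ideal_iff_isField_quotient q).mp hqmax
  rw [ringKrullDim_eq_zero_of_isField hfield] at hq
  exact zero_ne_one hq

variable {K : Type*} [Field K] {n r : ℕ} {P : Fin r → Ideal (PowerSeriesRing K n)}

theorem toBranch_smul (i : Fin r) (c : K) (g : LocalRing P) :
    toBranch P i (c • g) = c • toBranch P i g := by
  rw [smul_quotient_eq_algebraMap_mul, smul_quotient_eq_algebraMap_mul, map_mul]
  rfl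

theorem eq_zero_of_toBranch_eq_zero {g : LocalRing P} (h : ∀ i, toBranch P i g = 0) : g = 0 := by
  obtain ⟨f, rfl⟩ := Ideal.Quotient.mk_surjective g
  rw [Ideal.Quotient.eq_zero_iff_mem, Ideal.mem_iInf]
  exact fun i => Ideal.Quotient.eq_zero_iff_mem.mp (h i)

theorem v_sub_of_toBranch_eq_zero {i : Fin r} {t : LocalRing P} (f : LocalRing P)
    (ht : toBranch P i t = 0) : v P i (f - t) = v P i f := by
  rw [v, map_sub, ht, sub_zero]
  rfl

theorem isUnit_of_notMem_maxIdeal {g : LocalRing P} (h : g ∉ maxIdeal P) : IsUnit g := by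
  obtain ⟨f, rfl⟩ := Ideal.Quotient.mk_surjective g
  by_contra hg
  exact h (Ideal.mem_map_of_mem _ fun hf => hg (hf.map _))

namespace IsAlgebroidCurve

variable (hP : IsAlgebroidCurve P)

include hP

theorem isDiscreteValuationRing (i : Fin r) :
    ∃ _ : IsDomain (BranchRing P i), IsDiscreteValuationRing
      (integralClosure (BranchRing P i) (FractionRing (BranchRing P i))) := by
  have := hP.isPrime i
  exact ⟨inferInstance, isDiscreteValuationRing_integralClosure_branch (P i) (hP.krullDim_eq_one i)⟩

theorem v_mul (i : Fin r) (a b : LocalRing P) : v P i (a * b) = v P i a + v P i b := by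
  obtain ⟨_, _⟩ := hP.isDiscreteValuationRing i
  rw [v, map_mul, normVal_mul]
  rfl

theorem min_v_le_v_add (i : Fin r) (a b : LocalRing P) :
    min (v P i a) (v P i b) ≤ v P i (a + b) := by
  obtain ⟨_, _⟩ := hP.isDiscreteValuationRing i
  simp only [v, map_add]
  exact min_normVal_le_normVal_add _ _

theorem v_neg (i : Fin r) (a : LocalRing P) : v P i (-a) = v P i a := by
  obtain ⟨_, _⟩ := hP.isDiscreteValuationRing i
  simp only [v, map_neg, normVal_neg]

theorem min_v_le_v_sub (i : Fin r) (a b : LocalRing P) :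
    min (v P i a) (v P i b) ≤ v P i (a - b) := by
  rw [sub_eq_add_neg, ← hP.v_neg i b]
  exact hP.min_v_le_v_add i a (-b)

theorem v_eq_top_iff {i : Fin r} {a : LocalRing P} : v P i a = ⊤ ↔ toBranch P i a = 0 := by
  obtain ⟨_, _⟩ := hP.isDiscreteValuationRing i
  exact normVal_eq_top_iff

theorem exists_v_ne_top {a : LocalRing P} (ha : a ≠ 0) : ∃ i, v P i a ≠ ⊤ := by
  by_contra! h
  exact ha (eq_zero_of_toBranch_eq_zero fun i => hP.v_eq_top_iff.mp (h i))

theorem v_of_isUnit (i : Fin r) {a : LocalRing P} (ha : IsUnit a) : v P i a = 0 := by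
  obtain ⟨_, _⟩ := hP.isDiscreteValuationRing i
  exact normVal_eq_zero_iff.mpr (ha.map _)

theorem v_one (i : Fin r) : v P i 1 = 0 := hP.v_of_isUnit i isUnit_one

theorem v_pow (i : Fin r) (a : LocalRing P) (m : ℕ) : v P i (a ^ m) = m * v P i a := by
  induction m with
  | zero => simp [hP.v_one]
  | succ m ih => rw [pow_succ, hP.v_mul, ih]; push_cast; ring

theorem v_prod {ι : Type*} (i : Fin r) (s : Finset ι) (f : ι → LocalRing P) :
    v P i (∏ x ∈ s, f x) = ∑ x ∈ s, v P i (f x) := by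
  classical
  induction s using Finset.induction_on with
  | empty => simp [hP.v_one]
  | insert a s ha ih => rw [Finset.prod_insert ha, Finset.sum_insert ha, hP.v_mul, ih]

theorem v_smul (i : Fin r) {c : K} (hc : c ≠ 0) (a : LocalRing P) : v P i (c • a) = v P i a := by
  rw [smul_quotient_eq_algebraMap_mul, hP.v_mul, hP.v_of_isUnit, zero_add]
  exact (Ne.isUnit hc).map _

theorem v_pos_of_mem_maxIdeal (i : Fin r) {a : LocalRing P} (ha : a ∈ maxIdeal P) :
    0 < v P i a := by
  obtain ⟨_, _⟩ := hP.isDiscreteValuationRing i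
  have := hP.isPrime i
  rw [pos_iff_ne_zero]
  intro h0
  have hunit : IsUnit (toBranch P i a) := normVal_eq_zero_iff.mp h0
  have hloc := IsLocalHom.of_surjective (Ideal.Quotient.mk (P i)) Ideal.Quotient.mk_surjective
  have hle : maxIdeal P ≤ (IsLocalRing.maximalIdeal (BranchRing P i)).comap (toBranch P i) := by
    refine Ideal.map_le_iff_le_comap.mpr fun f hf => ?_
    change Ideal.Quotient.mk (P i) f ∈ IsLocalRing.maximalIdeal (BranchRing P i)
    exact map_nonunit _ _ hf
  exact hle ha hunit

theorem mem_maxIdeal_of_v_ne_zero {i : Fin r} {a : LocalRing P} (ha : v P i a ≠ 0) :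
    a ∈ maxIdeal P := by
  by_contra h
  exact ha (hP.v_of_isUnit i (isUnit_of_notMem_maxIdeal h))

theorem exists_v_lt_v_sub [IsAlgClosed K] {i : Fin r} {a b : LocalRing P}
    (hab : v P i a = v P i b) (ha : v P i a ≠ ⊤) : ∃ c : K, v P i a < v P i (a - c • b) := by
  have := hP.isPrime i
  obtain ⟨c, hc⟩ := exists_normVal_lt_normVal_sub (P i) (hP.krullDim_eq_one i) hab ha
  refine ⟨c, ?_⟩
  rw [v, v, map_sub, toBranch_smul]
  exact hc

theorem exists_mem_notMem (i : Fin r) : ∃ u, u ∉ P i ∧ ∀ j, j ≠ i → u ∈ P j := by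
  have hprime := hP.isPrime
  have h : ∀ j, ∃ u, u ∉ P i ∧ (j ≠ i → u ∈ P j) := by
    intro j
    by_cases hj : j = i
    · exact ⟨1, (P i).ne_top_iff_one.mp (hprime i).ne_top, fun h => absurd hj h⟩
    · by_contra! hu
      have hle : P j ≤ P i := fun x hx => by
        by_contra hxi
        exact (hu x hxi).2 hx
      exact hj (hP.injective (le_imp_eq_of_ringKrullDim_quotient_eq_one
        (hP.krullDim_eq_one j) (hP.krullDim_eq_one i) hle))
  choose u hu huj using h
  refine ⟨∏ j, u j, ?_, fun j hj => ?_⟩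
  · rw [(hprime i).prod_mem_iff]
    rintro ⟨j, -, hj⟩
    exact hu j hj
  · exact (P j).mem_of_dvd (Finset.dvd_prod_of_mem u (Finset.mem_univ j)) (huj j hj)

/-- Every element of large value on a branch agrees there with an element vanishing on all the
other branches. -/
theorem exists_isolate : ∃ N : ℕ, ∀ i, ∀ f : LocalRing P, (N : ℕ∞) ≤ v P i f →
    ∃ t : LocalRing P, toBranch P i t = toBranch P i f ∧ ∀ j, j ≠ i → toBranch P j t = 0 := by
  have h : ∀ i, ∃ N : ℕ, ∀ f : LocalRing P, (N : ℕ∞) ≤ v P i f →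
      ∃ t : LocalRing P, toBranch P i t = toBranch P i f ∧ ∀ j, j ≠ i → toBranch P j t = 0 := by
    intro i
    have := hP.isPrime i
    obtain ⟨u, hu, huj⟩ := hP.exists_mem_notMem i
    -- For large value, `f` is a multiple of `u` on the branch `i`; the same multiple `u * s`,
    -- lifted to the curve, vanishes on the other branches because `u` does.
    obtain ⟨N, hN⟩ := exists_natCast_le_normVal_imp_dvd (P i) (hP.krullDim_eq_one i)
      (t := Ideal.Quotient.mk (P i) u) (by rwa [Ne, Ideal.Quotient.eq_zero_iff_mem])
    refine ⟨N, fun f hf => ?_⟩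
    obtain ⟨s, hs⟩ := hN _ hf
    obtain ⟨s, rfl⟩ := Ideal.Quotient.mk_surjective s
    refine ⟨Ideal.Quotient.mk _ (u * s), ?_, fun j hj => ?_⟩
    · rw [hs, ← map_mul]
      rfl
    · exact Ideal.Quotient.eq_zero_iff_mem.mpr ((P j).mul_mem_right _ (huj j hj))
  choose N hN using h
  refine ⟨∑ i, N i, fun i f hf => hN i f (le_trans ?_ hf)⟩
  exact_mod_cast Finset.single_le_sum (f := N) (fun _ _ => Nat.zero_le _) (Finset.mem_univ i)

end IsAlgebroidCurve

end AlgebroidCurve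

/-! ### Reductions in terms of values, and discarding one element. -/

namespace AlgebroidCurve

variable {K : Type*} [Field K] {n r : ℕ} {P : Fin r → Ideal (PowerSeriesRing K n)}

theorem gProd_add (G : Finset (LocalRing P)) (α β : LocalRing P → ℕ) :
    gProd G (α + β) = gProd G α * gProd G β := by
  simp only [gProd, Pi.add_apply, pow_add, Finset.prod_mul_distrib]

theorem gProd_smul (G : Finset (LocalRing P)) (m : ℕ) (α : LocalRing P → ℕ) :
    gProd G (m • α) = gProd G α ^ m := by
  simp only [gProd, Pi.smul_apply, smul_eq_mul, ← Finset.prod_pow]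
  exact Finset.prod_congr rfl fun x _ => by rw [mul_comm, pow_mul]

open Classical in
theorem gProd_eq_pow_mul_gProd_erase {G : Finset (LocalRing P)} {g : LocalRing P} (hg : g ∈ G)
    (α : LocalRing P → ℕ) : gProd G α = g ^ α g * gProd (G.erase g) α :=
  (Finset.mul_prod_erase G (fun x => x ^ α x) hg).symm

theorem exists_gProd_eq_of_subset {G H : Finset (LocalRing P)} (h : H ⊆ G)
    (α : LocalRing P → ℕ) : ∃ β, gProd G β = gProd H α := by
  classical
  refine ⟨fun x => if x ∈ H then α x else 0, ?_⟩
  simp only [gProd]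
  rw [← Finset.prod_subset h]
  · exact Finset.prod_congr rfl fun x hx => by rw [if_pos hx]
  · intro x _ hx
    rw [if_neg hx, pow_zero]

theorem exists_gProd_eq_of_mem {G : Finset (LocalRing P)} {g : LocalRing P} (hg : g ∈ G) :
    ∃ α, gProd G α = g := by
  obtain ⟨α, hα⟩ := exists_gProd_eq_of_subset (Finset.singleton_subset_iff.mpr hg) 1
  exact ⟨α, by rw [hα]; simp [gProd]⟩

variable (P) in
/-- Some `G`-product has values at least those of `f`, with equality at the `k`-th branch. -/
def IsAttained (G : Finset (LocalRing P)) (k : Fin r) (f : LocalRing P) : Prop :=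
  ∃ α : LocalRing P → ℕ, (∀ i, v P i f ≤ v P i (gProd G α)) ∧ v P k (gProd G α) = v P k f

theorem IsAttained.of_le {G : Finset (LocalRing P)} {k : Fin r} {f g : LocalRing P}
    (h : IsAttained P G k g) (hle : ∀ i, v P i f ≤ v P i g) (heq : v P k g = v P k f) :
    IsAttained P G k f := by
  obtain ⟨α, hα, hk⟩ := h
  exact ⟨α, fun i => (hle i).trans (hα i), hk.trans heq⟩

namespace IsAlgebroidCurve

variable (hP : IsAlgebroidCurve P)

include hP

theorem ne_zero_of_v_ne_top {i : Fin r} {a : LocalRing P} (ha : v P i a ≠ ⊤) : a ≠ 0 := by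
  rintro rfl
  exact ha (hP.v_eq_top_iff.mpr (map_zero _))

theorem v_le_v_smul (i : Fin r) (c : K) (a : LocalRing P) : v P i a ≤ v P i (c • a) := by
  rw [smul_quotient_eq_algebraMap_mul, hP.v_mul]
  exact le_add_self

theorem v_sub_eq_of_lt {i : Fin r} {a b : LocalRing P} (h : v P i a < v P i b) :
    v P i (a - b) = v P i a := by
  refine le_antisymm ?_ ((le_min le_rfl h.le).trans (hP.min_v_le_v_sub i a b))
  by_contra! hlt
  have := hP.min_v_le_v_add i (a - b) b
  rw [sub_add_cancel] at this
  exact absurd this (not_le.mpr (lt_min hlt h))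

theorem le_v_sub_smul {i : Fin r} {f x : LocalRing P} (h : v P i f ≤ v P i x) (c : K) :
    v P i f ≤ v P i (f - c • x) :=
  (le_min le_rfl (h.trans (hP.v_le_v_smul i c x))).trans (hP.min_v_le_v_sub i _ _)

/-- The value at `k` can rise only if `c • gProd G α` cancels the leading term of `g` there, which
forces equal values; conversely a suitable `c` exists as the residue field is `K`. -/
theorem admitsReduction_iff [IsAlgClosed K] {G : Finset (LocalRing P)} {g : LocalRing P} :
    AdmitsReduction P G g ↔ ∃ k, v P k g ≠ ⊤ ∧ IsAttained P G k g := by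
  constructor
  · rintro ⟨h, k, -, hk, c, α, rfl, hle, hlt⟩
    refine ⟨k, hk, α, ?_⟩
    have hc : c ≠ 0 := by
      rintro rfl
      rw [zero_smul, sub_zero] at hlt
      exact hlt.false
    have hall : ∀ i, v P i g ≤ v P i (gProd G α) := fun i => by
      rw [← hP.v_smul i hc (gProd G α), ← sub_sub_cancel g (c • gProd G α)]
      exact (le_min le_rfl (hle i)).trans (hP.min_v_le_v_sub i _ _)
    refine ⟨hall, le_antisymm ?_ (hall k)⟩
    by_contra! hgt
    rw [← hP.v_smul k hc (gProd G α)] at hgt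
    rw [hP.v_sub_eq_of_lt hgt] at hlt
    exact hlt.false
  · rintro ⟨k, hk, α, hle, heq⟩
    obtain ⟨c, hc⟩ := hP.exists_v_lt_v_sub heq.symm hk
    exact ⟨_, k, hP.ne_zero_of_v_ne_top hk, hk, c, α, rfl, fun i => hP.le_v_sub_smul (hle i) c, hc⟩

/-- Modulo a Standard Basis, the branch at which the value is attained can be prescribed. -/
theorem isAttained_of_isStandardBasis [IsAlgClosed K] {G : Finset (LocalRing P)}
    (hG : IsStandardBasis P G) {k : Fin r} {f : LocalRing P} (hf : v P k f ≠ ⊤) :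
    IsAttained P G k f := by
  obtain ⟨N₀, hN₀⟩ := hP.exists_isolate
  obtain ⟨m, hm⟩ := ENat.ne_top_iff_exists.mp hf
  -- `N₀` permits isolation beyond `N`; `m + 1` keeps the branch `k`, of value `m`, below `N`, so
  -- that it is never isolated.
  set N := max N₀ (m + 1) with hN
  -- Termination measure: the summand `1` makes any passage from a finite value to `⊤` a strict
  -- drop, even beyond `N`, where finite values are no longer distinguished.
  let d : ℕ∞ → ℕ := fun a => if a = ⊤ then 0 else 1 + (N - a.toNat)
  have hd : ∀ {a b : ℕ∞}, a ≤ b → d b ≤ d a := by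
    intro a b hab
    induction b using ENat.recTopCoe with
    | top => simp [d]
    | coe b =>
      lift a to ℕ using ne_top_of_le_ne_top (ENat.natCast_ne_top b) hab
      have : a ≤ b := by exact_mod_cast hab
      simp only [d, ENat.natCast_ne_top, if_false, ENat.toNat_natCast]
      omega
  have hd' : ∀ {a b : ℕ∞}, a < b → (a < N ∨ b = ⊤) → d b < d a := by
    intro a b hab h
    lift a to ℕ using hab.ne_top
    induction b using ENat.recTopCoe with
    | top => simp [d]
    | coe b =>
      have h1 : a < b := by exact_mod_cast hab
      have h2 : a < N := by
        rcases h with h | h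
        · exact_mod_cast h
        · exact absurd h (ENat.natCast_ne_top b)
      simp only [d, ENat.natCast_ne_top, if_false, ENat.toNat_natCast]
      omega
  induction hμ : ∑ i, d (v P i f) using Nat.strong_induction_on generalizing f with
  | _ μ ih =>
    have step : ∀ g, (∀ i, v P i f ≤ v P i g) → v P k g = v P k f →
        (∃ i, v P i f < v P i g ∧ (v P i f < N ∨ v P i g = ⊤)) → IsAttained P G k f := by
      rintro g hle heq ⟨i, hi, hi'⟩
      refine (ih (∑ i, d (v P i g)) ?_ (heq ▸ hf) (heq ▸ hm) rfl).of_le hle heq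
      rw [← hμ]
      exact Finset.sum_lt_sum (fun j _ => hd (hle j)) ⟨i, Finset.mem_univ i, hd' hi hi'⟩
    -- A large finite value is first turned into `⊤`. Once none is left, a reduction at a branch `l`
    -- that misses equality at `k` raises a value below `N`.
    by_cases hbig : ∃ i, (N : ℕ∞) ≤ v P i f ∧ v P i f ≠ ⊤
    · obtain ⟨i, hiN, hi⟩ := hbig
      have hki : k ≠ i := by
        rintro rfl
        rw [← hm] at hiN
        have : N ≤ m := by exact_mod_cast hiN
        omega
      obtain ⟨t, ht, htj⟩ := hN₀ i f (le_trans (by exact_mod_cast le_max_left _ _) hiN)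
      have htop : v P i (f - t) = ⊤ := hP.v_eq_top_iff.mpr (by rw [map_sub, ht, sub_self])
      refine step (f - t) (fun j => ?_) (v_sub_of_toBranch_eq_zero f (htj k hki))
        ⟨i, htop ▸ lt_top_iff_ne_top.mpr hi, .inr htop⟩
      by_cases hj : j = i
      · rw [hj, htop]
        exact le_top
      · exact (v_sub_of_toBranch_eq_zero f (htj j hj)).ge
    · push Not at hbig
      obtain ⟨l, hl, α, hα, hαl⟩ :=
        hP.admitsReduction_iff.mp (hG.admitsReduction f (hP.ne_zero_of_v_ne_top hf))
      rcases (hα k).eq_or_lt with hk | hk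
      · exact ⟨α, hα, hk.symm⟩
      · obtain ⟨c, hc⟩ := hP.exists_v_lt_v_sub hαl.symm hl
        refine step (f - c • gProd G α) (fun i => hP.le_v_sub_smul (hα i) c)
          (hP.v_sub_eq_of_lt (hk.trans_le (hP.v_le_v_smul k c _))) ⟨l, hc, .inl ?_⟩
        by_contra! h
        exact hl (hbig l h)

theorem v_gProd_eq_zero {H : Finset (LocalRing P)} (hH : ∀ x ∈ H, x ∈ maxIdeal P) {k : Fin r}
    {α : LocalRing P → ℕ} (h : v P k (gProd H α) = 0) : gProd H α = 1 := by
  rw [gProd, hP.v_prod, Finset.sum_eq_zero_iff] at h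
  refine Finset.prod_eq_one fun x hx => ?_
  have := h x hx
  rw [hP.v_pow, mul_eq_zero] at this
  rcases this with h0 | h0
  · rw [Nat.cast_eq_zero.mp h0, pow_zero]
  · exact absurd h0 (hP.v_pos_of_mem_maxIdeal k (hH x hx)).ne'

open Classical in
-- If the given product misses equality at `k`, the reduction `h` of `g` at `l` has the same value
-- as `g` at `k` but a larger one at `l`. A `G`-product attaining `h` at `k` cannot involve `g`.
theorem isAttained_erase_self [IsAlgClosed K] {G : Finset (LocalRing P)}
    (hG : IsStandardBasis P G) {g : LocalRing P} (hg : g ∈ G)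
    (hred : AdmitsReduction P (G.erase g) g) {k : Fin r} (hk : v P k g ≠ ⊤) :
    IsAttained P (G.erase g) k g := by
  obtain ⟨l, hl, β, hβ, hβl⟩ := hP.admitsReduction_iff.mp hred
  rcases (hβ k).eq_or_lt with heq | hlt
  · exact ⟨β, hβ, heq.symm⟩
  obtain ⟨c, hc⟩ := hP.exists_v_lt_v_sub hβl.symm hl
  have hle := fun i => hP.le_v_sub_smul (hβ i) c
  have heq := hP.v_sub_eq_of_lt (hlt.trans_le (hP.v_le_v_smul k c _))
  set h := g - c • gProd (G.erase g) β
  obtain ⟨α, hα, hαk⟩ := hP.isAttained_of_isStandardBasis hG (heq ▸ hk)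
  rcases Nat.eq_zero_or_eq_succ_pred (α g) with h0 | h0
  · refine ⟨α, ?_⟩
    rw [gProd_eq_pow_mul_gProd_erase hg, h0, pow_zero, one_mul] at hα hαk
    exact ⟨fun i => (hle i).trans (hα i), hαk.trans heq⟩
  -- If `g` occurs, comparing positive finite values at `k` leaves exponent one and a trivial
  -- cofactor, so the product is `g` itself; but its value at `l` is at least that of `h`, which
  -- exceeds that of `g`.
  · exfalso
    rw [gProd_eq_pow_mul_gProd_erase hg] at hα hαk
    have hsum := hαk.trans heq
    rw [hP.v_mul, hP.v_pow] at hsum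
    have hpos := hP.v_pos_of_mem_maxIdeal k (hG.mem_maxIdeal g hg)
    have hs : v P k (gProd (G.erase g) α) ≠ ⊤ := ne_top_of_le_ne_top hk (hsum ▸ le_add_self)
    obtain ⟨m, hm⟩ := ENat.ne_top_iff_exists.mp hk
    obtain ⟨s, hs⟩ := ENat.ne_top_iff_exists.mp hs
    rw [← hm, ← hs, h0] at hsum
    rw [← hm] at hpos
    have hsum' : (α g).pred.succ * m + s = m := by exact_mod_cast hsum
    have hpos' : 0 < m := by exact_mod_cast hpos
    rw [Nat.succ_mul] at hsum'
    have hs0 : s = 0 := by omega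
    have ha0 : (α g).pred = 0 := by
      have : (α g).pred * m = 0 := by omega
      exact (mul_eq_zero.mp this).resolve_right hpos'.ne'
    have h1 : gProd (G.erase g) α = 1 :=
      hP.v_gProd_eq_zero (fun x hx => hG.mem_maxIdeal x (Finset.mem_of_mem_erase hx))
        (k := k) (by rw [← hs, hs0]; rfl)
    rw [h0, ha0, h1, mul_one, pow_one] at hα
    exact absurd (hα l) (not_le.mpr hc)

theorem not_isAttained_empty {f : LocalRing P} (hf : f ∈ maxIdeal P) (k : Fin r) :
    ¬ IsAttained P ∅ k f := by
  rintro ⟨α, -, hα⟩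
  have h1 : gProd (∅ : Finset (LocalRing P)) α = 1 := Finset.prod_empty
  rw [h1, hP.v_one] at hα
  exact (hP.v_pos_of_mem_maxIdeal k hf).ne hα

open Classical in
theorem isStandardBasis_erase [IsAlgClosed K] {G : Finset (LocalRing P)}
    (hG : IsStandardBasis P G) {g : LocalRing P} (hg : g ∈ G)
    (hred : AdmitsReduction P (G.erase g) g) : IsStandardBasis P (G.erase g) where
  nonempty := by
    rw [Finset.nonempty_iff_ne_empty]
    intro h0
    obtain ⟨k, -, hk⟩ := hP.admitsReduction_iff.mp hred
    rw [h0] at hk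
    exact hP.not_isAttained_empty (hG.mem_maxIdeal g hg) k hk
  mem_maxIdeal x hx := hG.mem_maxIdeal x (Finset.mem_of_mem_erase hx)
  ne_zero x hx := hG.ne_zero x (Finset.mem_of_mem_erase hx)
  admitsReduction f hf := by
    obtain ⟨k, hk, α, hα, hαk⟩ := hP.admitsReduction_iff.mp (hG.admitsReduction f hf)
    refine hP.admitsReduction_iff.mpr ⟨k, hk, ?_⟩
    rw [gProd_eq_pow_mul_gProd_erase hg] at hα hαk
    by_cases h0 : α g = 0
    · rw [h0, pow_zero, one_mul] at hα hαk
      exact ⟨α, hα, hαk⟩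
    -- The substitute for `g` must be exact at the branch where `f` is attained, which need not be
    -- the branch where `g` was reduced. It exists since `g` divides a product of finite value at
    -- `k`.
    have hgk : v P k g ≠ ⊤ := by
      intro htop
      rw [hP.v_mul, hP.v_pow, htop, ENat.mul_top (by exact_mod_cast h0), top_add] at hαk
      exact hk hαk.symm
    obtain ⟨δ, hδ, hδk⟩ := hP.isAttained_erase_self hG hg hred hgk
    refine ⟨α g • δ + α, fun i => (hα i).trans ?_, ?_⟩
    · rw [gProd_add, gProd_smul, hP.v_mul, hP.v_mul, hP.v_pow, hP.v_pow]
      gcongr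
      exact hδ i
    · rw [← hαk, gProd_add, gProd_smul, hP.v_mul, hP.v_mul, hP.v_pow, hP.v_pow, hδk]

end IsAlgebroidCurve

end AlgebroidCurve

/-! ### Sequences of discards and existence of a Standard Basis. -/

namespace AlgebroidCurve

variable {K : Type*} [Field K] {n r : ℕ} {P : Fin r → Ideal (PowerSeriesRing K n)}

open Classical in
theorem reflTransGen_discardStep_induction {p : Finset (LocalRing P) → Prop}
    (hp : ∀ G, p G → ∀ g ∈ G, AdmitsReduction P (G.erase g) g → p (G.erase g))
    {G G' : Finset (LocalRing P)} (h : Relation.ReflTransGen (DiscardStep P) G G') (hG : p G) :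
    p G' := by
  induction h with
  | refl => exact hG
  | tail _ hstep ih =>
    obtain ⟨g, hg, hred, rfl⟩ := hstep
    exact hp _ ih g hg hred

theorem exists_reflTransGen_discardStep (G : Finset (LocalRing P)) :
    ∃ G', Relation.ReflTransGen (DiscardStep P) G G' ∧ ¬ ∃ G'', DiscardStep P G' G'' := by
  induction hc : G.card using Nat.strong_induction_on generalizing G with
  | _ m ih =>
    by_cases h : ∃ G'', DiscardStep P G G''
    · obtain ⟨G₁, hstep⟩ := h
      have hcard : G₁.card < m := by
        obtain ⟨g, hg, -, rfl⟩ := hstep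
        rw [← hc]
        classical exact Finset.card_erase_lt_of_mem hg
      obtain ⟨G', hG', hmin⟩ := ih _ hcard G₁ rfl
      exact ⟨G', .head hstep hG', hmin⟩
    · exact ⟨G, .refl, h⟩

theorem IsStandardBasis.isMinimal {G : Finset (LocalRing P)} (hG : IsStandardBasis P G)
    (h : ¬ ∃ G', DiscardStep P G G') : IsMinimalStandardBasis P G :=
  ⟨hG, fun g hg hred => h ⟨_, g, hg, hred, rfl⟩⟩

namespace IsAlgebroidCurve

variable (hP : IsAlgebroidCurve P)

include hP

theorem exists_mem_maxIdeal_ne_zero : ∃ f ∈ maxIdeal P, f ≠ 0 := by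
  by_contra! h
  have : Subsingleton (maxIdeal P) :=
    ⟨fun a b => Subtype.ext ((h a a.2).trans (h b b.2).symm)⟩
  have : Subsingleton (maxIdeal P).Cotangent := (maxIdeal P).toCotangent_surjective.subsingleton
  have h0 := hP.nondegenerate
  rw [Module.finrank_zero_of_subsingleton] at h0
  have := hP.one_lt
  omega

/-- The components of large value of an element can be replaced by `0`. -/
theorem exists_v_eq_ite : ∃ N : ℕ, ∀ N' ≥ N, ∀ f : LocalRing P, ∃ g : LocalRing P,
    ∀ i, v P i g = if v P i f < N' then v P i f else ⊤ := by
  obtain ⟨N, hN⟩ := hP.exists_isolate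
  refine ⟨N, fun N' hN' f => ?_⟩
  -- The branches are killed one at a time; isolating one leaves the values at the others untouched.
  have key : ∀ s : Finset (Fin r), (∀ i ∈ s, (N' : ℕ∞) ≤ v P i f) → ∃ g : LocalRing P,
      ∀ i, v P i g = if i ∈ s then ⊤ else v P i f := by
    intro s
    induction s using Finset.induction_on with
    | empty => exact fun _ => ⟨f, fun i => by simp⟩
    | insert a s ha ih =>
      intro hs
      obtain ⟨g, hg⟩ := ih fun i hi => hs i (Finset.mem_insert_of_mem hi)
      have hga : (N : ℕ∞) ≤ v P a g := by
        rw [hg, if_neg ha]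
        exact le_trans (by exact_mod_cast hN') (hs a (Finset.mem_insert_self a s))
      obtain ⟨t, ht, htj⟩ := hN a g hga
      refine ⟨g - t, fun i => ?_⟩
      by_cases hi : i = a
      · subst hi
        rw [if_pos (Finset.mem_insert_self _ _), hP.v_eq_top_iff, map_sub, ht, sub_self]
      · rw [v_sub_of_toBranch_eq_zero g (htj i hi), hg]
        simp [Finset.mem_insert, hi]
  obtain ⟨g, hg⟩ := key (Finset.univ.filter fun i => (N' : ℕ∞) ≤ v P i f) (by simp)
  refine ⟨g, fun i => ?_⟩
  rw [hg]
  by_cases h : v P i f < N'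
  · simp [h]
  · simp [not_lt.mp h]

omit hP in
/-- Finitely many elements of the maximal ideal realize all the value vectors whose entries are
infinite or less than `N`. -/
theorem exists_finset_bounded_values (N : ℕ) : ∃ G : Finset (LocalRing P),
    (∀ x ∈ G, x ∈ maxIdeal P ∧ x ≠ 0) ∧
    ∀ f ∈ maxIdeal P, f ≠ 0 → (∀ i, v P i f < N ∨ v P i f = ⊤) →
      ∃ x ∈ G, ∀ i, v P i x = v P i f := by
  set S : Set (LocalRing P) := {f | (f ∈ maxIdeal P ∧ f ≠ 0) ∧ ∀ i, v P i f < N ∨ v P i f = ⊤}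
  let F : LocalRing P → Fin r → ℕ∞ := fun f i => v P i f
  have hfin : (F '' S).Finite := by
    have hT : {a : ℕ∞ | a < N ∨ a = ⊤}.Finite := by
      refine (((Finset.range N).image (fun m : ℕ => (m : ℕ∞)) ∪ {⊤}).finite_toSet).subset ?_
      rintro a (ha | rfl)
      · lift a to ℕ using ha.ne_top
        have : a < N := by exact_mod_cast ha
        simp [this]
      · simp
    refine (Set.Finite.pi' fun _ => hT).subset ?_
    rintro _ ⟨f, hf, rfl⟩ i
    exact hf.2 i
  classical
  obtain ⟨G, hGS, hG⟩ := Finset.subset_set_image_iff.mp hfin.coe_toFinset.subset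
  refine ⟨G, fun x hx => (hGS hx).1, fun f hf hf0 hfN => ?_⟩
  have : F f ∈ hfin.toFinset := hfin.mem_toFinset.mpr ⟨f, ⟨⟨hf, hf0⟩, hfN⟩, rfl⟩
  rw [← hG, Finset.mem_image] at this
  obtain ⟨x, hx, hxf⟩ := this
  exact ⟨x, hx, fun i => congrFun hxf i⟩

/-- The products of finitely many elements vanishing on all branches but the `i`-th realize all the
values on that branch of such elements of the maximal ideal. -/
theorem exists_finset_isolated_values (i : Fin r) : ∃ G : Finset (LocalRing P),
    (∀ x ∈ G, x ∈ maxIdeal P ∧ x ≠ 0) ∧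
    ∀ f ∈ maxIdeal P, v P i f ≠ ⊤ → (∀ j, j ≠ i → v P j f = ⊤) →
      ∃ α, ∀ j, v P j (gProd G α) = v P j f := by
  set E : Set (LocalRing P) := {f | f ∈ maxIdeal P ∧ v P i f ≠ ⊤ ∧ ∀ j, j ≠ i → v P j f = ⊤}
  let w : LocalRing P → ℕ := fun f => (v P i f).toNat
  have hw : ∀ f ∈ E, v P i f = w f := fun f hf => (ENat.natCast_toNat hf.2.1).symm
  obtain ⟨T, hT⟩ := Nat.addSubmonoid_fg (AddSubmonoid.closure (w '' E))
  -- `E` is closed under products, so its set of values is closed under addition and the generated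
  -- monoid adds at most `0`. The nonzero generators are therefore values of elements of `E`.
  have hclosure : ∀ m ∈ AddSubmonoid.closure (w '' E), m = 0 ∨ ∃ f ∈ E, w f = m := by
    intro m hm
    induction hm using AddSubmonoid.closure_induction with
    | mem m hm => exact .inr hm
    | zero => exact .inl rfl
    | add a b _ _ ha hb =>
      rcases ha with rfl | ⟨f, hf, rfl⟩
      · simpa using hb
      rcases hb with rfl | ⟨g, hg, rfl⟩
      · exact .inr ⟨f, hf, rfl⟩
      have hv : v P i (f * g) = (w f + w g : ℕ) := by
        rw [hP.v_mul, hw f hf, hw g hg]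
        push_cast
        rfl
      refine .inr ⟨f * g, ⟨Ideal.mul_mem_left _ _ hg.1, hv ▸ ENat.natCast_ne_top _, fun j hj => ?_⟩, ?_⟩
      · rw [hP.v_mul, hf.2.2 j hj, top_add]
      · simp only [w, hv, ENat.toNat_natCast]
  classical
  have hsub : ((T.erase 0 : Finset ℕ) : Set ℕ) ⊆ w '' E := by
    intro m hm
    rw [Finset.mem_coe, Finset.mem_erase] at hm
    exact (hclosure m (hT ▸ AddSubmonoid.subset_closure hm.2)).resolve_left hm.1
  obtain ⟨G, hGE, hG⟩ := Finset.subset_set_image_iff.mp hsub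
  refine ⟨G, fun x hx => ⟨(hGE hx).1, hP.ne_zero_of_v_ne_top (hGE hx).2.1⟩, ?_⟩
  -- Zero is set apart: the empty product has value `0` at `i` but does not vanish on the other
  -- branches.
  have key : ∀ m ∈ AddSubmonoid.closure (T : Set ℕ), m = 0 ∨
      ∃ α, v P i (gProd G α) = m ∧ ∀ j, j ≠ i → v P j (gProd G α) = ⊤ := by
    intro m hm
    induction hm using AddSubmonoid.closure_induction with
    | mem m hm =>
      by_cases h0 : m = 0
      · exact .inl h0
      have : m ∈ G.image w := hG ▸ Finset.mem_erase.mpr ⟨h0, hm⟩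
      obtain ⟨x, hx, rfl⟩ := Finset.mem_image.mp this
      obtain ⟨α, hα⟩ := exists_gProd_eq_of_mem hx
      exact .inr ⟨α, by rw [hα, hw x (hGE hx)], fun j hj => by rw [hα]; exact (hGE hx).2.2 j hj⟩
    | zero => exact .inl rfl
    | add a b _ _ ha hb =>
      rcases ha with rfl | ⟨α, hα, hαj⟩
      · simpa using hb
      rcases hb with rfl | ⟨β, hβ, hβj⟩
      · exact .inr ⟨α, by simpa using hα, hαj⟩
      refine .inr ⟨α + β, ?_, fun j hj => ?_⟩
      · rw [gProd_add, hP.v_mul, hα, hβ]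
        push_cast
        rfl
      · rw [gProd_add, hP.v_mul, hαj j hj, top_add]
  intro f hf hfi hfj
  have hfE : f ∈ E := ⟨hf, hfi, hfj⟩
  have hfw : w f ∈ AddSubmonoid.closure (T : Set ℕ) :=
    hT ▸ AddSubmonoid.subset_closure ⟨f, hfE, rfl⟩
  rcases key _ hfw with h0 | ⟨α, hα, hαj⟩
  · have := (hP.v_pos_of_mem_maxIdeal i hf).ne'
    rw [hw f hfE, h0] at this
    exact absurd rfl this
  · refine ⟨α, fun j => ?_⟩
    by_cases hj : j = i
    · rw [hj, hα, hw f hfE]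
    · rw [hαj j hj, hfj j hj]

/-- Two finite families suffice. `G₀` serves elements with some value below `N`, whose large values
may be replaced by `⊤`; the families `H k` serve nonzero elements all of whose values are at least
`N`, which can be isolated on one branch `k` of finite value. Units are attained by the empty
product. -/
theorem exists_isStandardBasis [IsAlgClosed K] :
    ∃ G : Finset (LocalRing P), IsStandardBasis P G := by
  obtain ⟨N₁, hN₁⟩ := hP.exists_isolate
  obtain ⟨N₂, hN₂⟩ := hP.exists_v_eq_ite
  set N := max (max N₁ N₂) 1
  obtain ⟨G₀, hG₀, hG₀v⟩ := exists_finset_bounded_values (P := P) N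
  choose H hH hHv using hP.exists_finset_isolated_values
  classical
  set G := G₀ ∪ Finset.univ.biUnion H
  have hmem : ∀ x ∈ G, x ∈ maxIdeal P ∧ x ≠ 0 := by
    intro x hx
    rcases Finset.mem_union.mp hx with hx | hx
    · exact hG₀ x hx
    · obtain ⟨i, -, hx⟩ := Finset.mem_biUnion.mp hx
      exact hH i x hx
  have hred : ∀ f : LocalRing P, f ≠ 0 → ∃ k, v P k f ≠ ⊤ ∧ IsAttained P G k f := by
    intro f hf0
    by_cases hf : f ∈ maxIdeal P
    swap
    · obtain ⟨k, hk⟩ := hP.exists_v_ne_top hf0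
      have h0 := fun i => hP.v_of_isUnit i (isUnit_of_notMem_maxIdeal hf)
      have h1 : gProd G 0 = 1 := by simp [gProd]
      exact ⟨k, hk, 0, fun i => by rw [h0]; exact zero_le, by rw [h0, h1, hP.v_one]⟩
    by_cases hsmall : ∃ k, v P k f < N
    · obtain ⟨k, hk⟩ := hsmall
      -- Raising the large values of `f` to `⊤` is harmless, since attainment asks for equality only
      -- at `k`.
      obtain ⟨g, hg⟩ := hN₂ N ((le_max_right _ _).trans (le_max_left _ _)) f
      have hgk : v P k g = v P k f := by rw [hg, if_pos hk]
      have hgm : g ∈ maxIdeal P := hP.mem_maxIdeal_of_v_ne_zero (i := k)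
        (hgk ▸ (hP.v_pos_of_mem_maxIdeal k hf).ne')
      have hg0 : g ≠ 0 := hP.ne_zero_of_v_ne_top (hgk ▸ hk.ne_top)
      obtain ⟨x, hx, hxg⟩ := hG₀v g hgm hg0 fun i => by
        rw [hg]
        by_cases h : v P i f < N
        · simp [h]
        · simp [h]
      obtain ⟨α, hα⟩ := exists_gProd_eq_of_mem (Finset.mem_union_left _ hx : x ∈ G)
      refine ⟨k, hk.ne_top, α, fun i => ?_, by rw [hα, hxg, hgk]⟩
      rw [hα, hxg, hg]
      split_ifs
      · exact le_rfl
      · exact le_top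
    · push Not at hsmall
      obtain ⟨k, hk⟩ := hP.exists_v_ne_top hf0
      obtain ⟨t, htk, htj⟩ := hN₁ k f (le_trans
        (by exact_mod_cast (le_max_left _ _).trans (le_max_left _ _)) (hsmall k))
      have hvk : v P k t = v P k f := by rw [v, htk]; rfl
      have hvj : ∀ j, j ≠ k → v P j t = ⊤ := fun j hj => hP.v_eq_top_iff.mpr (htj j hj)
      have htm : t ∈ maxIdeal P := hP.mem_maxIdeal_of_v_ne_zero (i := k)
        (hvk ▸ (hP.v_pos_of_mem_maxIdeal k hf).ne')
      obtain ⟨α, hα⟩ := hHv k t htm (hvk ▸ hk) hvj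
      obtain ⟨β, hβ⟩ := exists_gProd_eq_of_subset (G := G) (H := H k)
        ((Finset.subset_biUnion_of_mem H (Finset.mem_univ k)).trans Finset.subset_union_right) α
      refine ⟨k, hk, β, fun i => ?_, by rw [hβ, hα, hvk]⟩
      rw [hβ, hα]
      by_cases hi : i = k
      · rw [hi, hvk]
      · rw [hvj i hi]
        exact le_top
  refine ⟨G, ?_, fun x hx => (hmem x hx).1, fun x hx => (hmem x hx).2,
    fun f hf => hP.admitsReduction_iff.mpr (hred f hf)⟩
  obtain ⟨f, hf, hf0⟩ := hP.exists_mem_maxIdeal_ne_zero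
  obtain ⟨k, -, hk⟩ := hred f hf0
  rw [Finset.nonempty_iff_ne_empty]
  intro h
  rw [h] at hk
  exact hP.not_isAttained_empty hf k hk

end IsAlgebroidCurve

end AlgebroidCurve

open AlgebroidCurve Classical in
theorem proposition14 {K : Type*} [Field K] [IsAlgClosed K] {n r : ℕ}
    (P : Fin r → Ideal (PowerSeriesRing K n)) (hP : IsAlgebroidCurve P) :
    -- discarding a reducible element preserves Standard Bases
    (∀ G : Finset (LocalRing P), IsStandardBasis P G →
      ∀ g ∈ G, AdmitsReduction P (G.erase g) g → IsStandardBasis P (G.erase g)) ∧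
    -- discarding reducible elements, as long as there are any, ends in a minimal Standard Basis
    (∀ G : Finset (LocalRing P), IsStandardBasis P G →
      (∀ G', Relation.ReflTransGen (DiscardStep P) G G' → (¬ ∃ G'', DiscardStep P G' G'') →
        IsMinimalStandardBasis P G') ∧
      (∃ G', Relation.ReflTransGen (DiscardStep P) G G' ∧ IsMinimalStandardBasis P G')) ∧
    -- a minimal Standard Basis exists
    (∃ G : Finset (LocalRing P), IsMinimalStandardBasis P G) := by
  have herase : ∀ G : Finset (LocalRing P), IsStandardBasis P G →
      ∀ g ∈ G, AdmitsReduction P (G.erase g) g → IsStandardBasis P (G.erase g) :=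
    fun G hG g hg hred => hP.isStandardBasis_erase hG hg hred
  have hterminal : ∀ G : Finset (LocalRing P), IsStandardBasis P G →
      ∀ G', Relation.ReflTransGen (DiscardStep P) G G' → (¬ ∃ G'', DiscardStep P G' G'') →
        IsMinimalStandardBasis P G' := fun G hG G' hGG' hmin =>
    (reflTransGen_discardStep_induction herase hGG' hG).isMinimal hmin
  have hexists : ∀ G : Finset (LocalRing P), IsStandardBasis P G →
      ∃ G', Relation.ReflTransGen (DiscardStep P) G G' ∧ IsMinimalStandardBasis P G' := by
    intro G hG
    obtain ⟨G', hGG', hmin⟩ := exists_reflTransGen_discardStep G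
    exact ⟨G', hGG', hterminal G hG G' hGG' hmin⟩
  refine ⟨herase, fun G hG => ⟨hterminal G hG, hexists G hG⟩, ?_⟩
  obtain ⟨G, hG⟩ := hP.exists_isStandardBasis
  obtain ⟨G', -, hG'⟩ := hexists G hG
  exact ⟨G', hG'⟩
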